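/- Let $p$ be a prime, let $G\cong C_p\times C_p$, and let $U$ be a $\mathbb{Z}_pG$-lattice, i.e. a $\mathbb{Z}_pG$-module that is free of finite rank over $\mathbb{Z}_p$. For a subgroup $H\le G$ put $\widehat H=\sum_{h\in H}h$. Let $I=\{0\}\cup\{H\le G : |H|=p\}$, let $e_0=\frac1{p^2}\widehat G$ and $e_H=\frac1{p^2}(p\widehat H-\widehat G)$ $(|H|=p)$ be the primitive idempotents of $\mathbb{Q}_pG$, and put $\Lambda_{(i)}=e_i\mathbb{Z}_pG\subseteq\mathbb{Q}_pG$ for $i\in I$. Assume that $U$ is reduced: it has no nonzero free direct summand and no direct summand isomorphic to any $\Lambda_{(i)}$. Regard $U$ as the sublattice $1\otimes U$ of $\mathbb{Q}_p\otimes_{\mathbb{Z}_p}U$, and put $U_{(i)}=e_iU$ for $i\in I$ and $U_*=\sum_{i\in I}U_{(i)}$. The (Butler) diagram of $U$ is $(V;V_{(i)},\,i\in I)$, where $V=U_*/U$ and $V_{(i)}=(U_{(i)}+U)/U\subseteq V$. Then $U$ is a permutation module (that is, $U$ has a $\mathbb{Z}_p$-basis permuted by $G$) if and only if $G$ acts trivially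 on each $V_{(i)}$, $i\in I$, and $$V=V_{(0)}=\bigoplus_{\substack{H\le G\\ |H|=p}}V_{(H)},$$ the sum being the internal direct sum of submodules of $V$. -/

import Mathlib

open scoped TensorProduct

noncomputable section

namespace Butler

variable (p : ℕ) [Fact p.Prime]

section Idempotents

variable (G : Type*) [CommGroup G]

/-- The subgroups of `G` of order `p`. -/
abbrev OrderP : Type _ := {H : Subgroup G // Nat.card H = p}

/-- The index set `I = {0} ∪ {H ≤ G : |H| = p}`: `none` is the index `0`, and `some H` is the
index `H`. -/
abbrev Idx : Type _ := Option (OrderP p G)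

variable {G} [Fintype G]

open Classical in
/-- The element `Ĥ = ∑_{h ∈ H} h` of the group algebra `ℚ_p G`. -/
def hat (H : Subgroup G) : MonoidAlgebra ℚ_[p] G :=
  ∑ g : G with g ∈ H, MonoidAlgebra.single g 1

/-- The primitive idempotents of `ℚ_p G` (for `G ≅ C_p × C_p`):
`e_0 = Ĝ / p²` and `e_H = (p Ĥ - Ĝ) / p²`. -/
def idem : Idx p G → MonoidAlgebra ℚ_[p] G
  | none => ((p : ℚ_[p]) ^ 2)⁻¹ • hat p (⊤ : Subgroup G)
  | some H => ((p : ℚ_[p]) ^ 2)⁻¹ • ((p : ℚ_[p]) • hat p H.1 - hat p (⊤ : Subgroup G))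

end Idempotents

variable {p} {G : Type*} [CommGroup G]
variable {U : Type*} [AddCommGroup U] [Module ℤ_[p] U] (ρ : Representation ℤ_[p] G U)

/-- `U` is a permutation module: it has a (finite) `ℤ_p`-basis that is permuted by `G`. -/
def IsPermutation : Prop :=
  ∃ (n : ℕ) (b : Module.Basis (Fin n) ℤ_[p] U), ∀ (g : G) (i : Fin n), ∃ j : Fin n,
    ρ g (b i) = b j

/-- `U` has a direct summand isomorphic to `W` as a `ℤ_p G`-module. -/
def HasSummand {W : Type*} [AddCommGroup W] [Module ℤ_[p] W]
    (σ : Representation ℤ_[p] G W) : Prop :=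
  ∃ U₁ U₂ : Subrepresentation ρ, IsCompl U₁ U₂ ∧ Nonempty (U₁.toRepresentation.Equiv σ)

/-- `ℚ_p U = ℚ_p ⊗ U` as a representation of `G` over `ℚ_p`. -/
def ratRep : Representation ℚ_[p] G (ℚ_[p] ⊗[ℤ_[p]] U) where
  toFun g := (ρ g).baseChange ℚ_[p]
  map_one' := by
    rw [map_one]; exact LinearMap.baseChange_id
  map_mul' g h := by
    rw [map_mul]; exact LinearMap.baseChange_comp _ _

/-- `ℚ_p U` as a representation of `G` over `ℤ_p`. -/
def intRep : Representation ℤ_[p] G (ℚ_[p] ⊗[ℤ_[p]] U) where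
  toFun g := (ratRep ρ g).restrictScalars ℤ_[p]
  map_one' := by rw [map_one]; rfl
  map_mul' g h := by rw [map_mul]; rfl

theorem intRep_tmul (g : G) (a : ℚ_[p]) (u : U) : intRep ρ g (a ⊗ₜ u) = a ⊗ₜ ρ g u := rfl

/-- `U`, regarded as the sublattice `1 ⊗ U` of `ℚ_p U`. -/
def lattice : Subrepresentation (intRep ρ) where
  toSubmodule := LinearMap.range (TensorProduct.mk ℤ_[p] ℚ_[p] U 1)
  apply_mem_toSubmodule := by
    rintro g _ ⟨u, rfl⟩
    exact ⟨ρ g u, rfl⟩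

variable [Fintype G]

/-- Multiplication `U → ℚ_p U`, `u ↦ e_i u = e_i (1 ⊗ u)`. -/
def idemMul (i : Idx p G) : U →ₗ[ℤ_[p]] ℚ_[p] ⊗[ℤ_[p]] U :=
  ((ratRep ρ).asAlgebraHom (idem p i)).restrictScalars ℤ_[p] ∘ₗ TensorProduct.mk ℤ_[p] ℚ_[p] U 1

theorem intRep_idemMul (i : Idx p G) (g : G) (u : U) :
    intRep ρ g (idemMul ρ i u) = idemMul ρ i (ρ g u) := by
  change ratRep ρ g ((ratRep ρ).asAlgebraHom (idem p i) (1 ⊗ₜ u)) =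
    (ratRep ρ).asAlgebraHom (idem p i) (ratRep ρ g (1 ⊗ₜ u))
  rw [← Representation.asAlgebraHom_single_one, ← Module.End.mul_apply, ← Module.End.mul_apply,
    ← map_mul, ← map_mul, mul_comm]

/-- `U_(i) = e_i U ⊆ ℚ_p U`. -/
def part (i : Idx p G) : Subrepresentation (intRep ρ) where
  toSubmodule := LinearMap.range (idemMul ρ i)
  apply_mem_toSubmodule := by
    rintro g _ ⟨u, rfl⟩
    exact ⟨ρ g u, (intRep_idemMul ρ i g u).symm⟩

variable (p G) in
/-- The module `Λ_(i) = e_i ℤ_p G ⊆ ℚ_p G = ℚ_p ⊗ ℤ_p G`. -/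
def lambda (i : Idx p G) :
    Representation ℤ_[p] G (part (Representation.leftRegular ℤ_[p] G) i).toSubmodule :=
  (part (Representation.leftRegular ℤ_[p] G) i).toRepresentation

/-- `U` is reduced: it has no direct summand isomorphic to `ℤ_p G` (equivalently, no nonzero free
direct summand), nor one isomorphic to some `Λ_(i)`. -/
def IsReduced : Prop :=
  ¬ HasSummand ρ (Representation.leftRegular ℤ_[p] G) ∧
    ∀ i : Idx p G, ¬ HasSummand ρ (lambda p G i)

/-- `U_* = ∑_i U_(i) ⊆ ℚ_p U`. -/
def hull : Subrepresentation (intRep ρ) where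
  toSubmodule := ⨆ i : Idx p G, (part ρ i).toSubmodule
  apply_mem_toSubmodule g := by
    change _ ≤ Submodule.comap (intRep ρ g) (⨆ i : Idx p G, (part ρ i).toSubmodule)
    refine iSup_le fun i v hv => ?_
    exact Submodule.mem_iSup_of_mem i ((part ρ i).apply_mem_toSubmodule g hv)

/-- The module `V = U_* / U` of the diagram of `U`. For reduced `U` it is annihilated by `p`, so
that its `ℤ_p G`-module structure is the same as its `𝔽_p G`-module structure. -/
abbrev DiagramSpace : Type _ :=
  (hull ρ).toSubmodule ⧸ (lattice ρ).toSubmodule.submoduleOf (hull ρ).toSubmodule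

/-- The action of `G` on `V = U_* / U`. -/
def diagramRep : Representation ℤ_[p] G (DiagramSpace ρ) :=
  (hull ρ).toRepresentation.quotient _ fun g v hv =>
    (lattice ρ).apply_mem_toSubmodule g (v := (v : ℚ_[p] ⊗[ℤ_[p]] U)) hv

/-- The submodule `V_(i) = (U_(i) + U) / U` of `V = U_* / U`. -/
def diagramPart (i : Idx p G) : Submodule ℤ_[p] (DiagramSpace ρ) :=
  (((part ρ i).toSubmodule ⊔ (lattice ρ).toSubmodule).submoduleOf (hull ρ).toSubmodule).map
    (Submodule.mkQ _)

end Butler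

end

/-! Write `R = ℤ_p G`, with maximal ideal `𝔪`, and `π_H` for the projection of a permutation module
onto the span of the basis elements with stabilizer `H`.

From permutation module to diagram: each orbit of a permuted basis spans a direct summand. A trivial
stabilizer would give a summand `R`, and the stabilizer `G` a summand `Λ_(0)`, so reducedness leaves
only stabilizers of order `p`. A basis element with stabilizer `H` is killed by `e_L` for `L ≠ H`,
whence `e_H x = π_H x - e_0 (π_H x)` on all of `U` (`idem_some_apply`). Modulo `U` this reads `e_H x
≡ -e_0 (π_H x)`, and every condition on the diagram follows from it
(`IsIdemSystem.diagram_of_permutation`).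

From diagram to permutation module: `U_(i)` is a torsion-free module over the discrete valuation
ring `Λ_(i) = R / ann e_i`. An element of `U ∩ U_(i)` outside `𝔪 U_(i)` would split off a copy of
`Λ_(i)` from `U` (`IsIdemSystem.exists_complement`), so reducedness gives `U ∩ U_(i) ⊆ 𝔪 U_(i)`.
Trivial action together with `V_(0) ⊆ ∑ V_(H)` gives the reverse inclusion `𝔪 U_(i) ⊆ U`
(`IsIdemSystem.maxIdeal_smul_le`). Hence `V_(i) = U_(i) / 𝔪 U_(i)`, and bases of `V_(i)` lift to
`Λ_(i)`-bases of `U_(i)`.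

Lift bases of all `V_(H)` to elements `x_s`, and choose `y_s ∈ U_(0)` with `z_s = x_s - y_s ∈ U`.
Because `V_(0) = ⨁ V_(H)`, the `y_s` form a basis of `U_(0)`. The `z_s` then generate `U`, each is
fixed by its `H`, and the coefficients in any relation among them are killed by `Ĥ`
(`IsIdemSystem.exists_generators`). So `U` is a direct sum of modules `ℤ_p[G/H]`
(`exists_permuted_basis`). -/

set_option linter.unusedSectionVars false

open scoped TensorProduct

noncomputable section

namespace Butler

open MonoidAlgebra (single)

/-! ### Nakayama-type arguments: residue bases and split summands -/

section CommutativeAlgebra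

variable {R E : Type*} [CommRing R] [AddCommGroup E] [Module R E]

/-- A finite family in `P` whose residues form a basis of `P / 𝔪 P`. -/
structure IsResidueBasis {J : Type*} [Fintype J] (𝔪 : Ideal R) (P : Submodule R E) (x : J → E) :
    Prop where
  mem : ∀ j, x j ∈ P
  le_span_sup : P ≤ Submodule.span R (Set.range x) ⊔ 𝔪 • P
  mem_of_sum_mem : ∀ a : J → R, ∑ j, a j • x j ∈ 𝔪 • P → ∀ j, a j ∈ 𝔪

/-- A prescribed `u` outside `𝔪 P` can be made a member of the family; this is what later lets `u`
generate a direct summand. -/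
theorem exists_isResidueBasis {𝔪 : Ideal R} [𝔪.IsMaximal] {P : Submodule R E}
    (hP : P.FG) (u : P) :
    ∃ (n : ℕ) (x : Fin n → E), IsResidueBasis 𝔪 P x ∧ ((u : E) ∉ 𝔪 • P → ∃ j, x j = u) := by
  classical
  let := Ideal.Quotient.field 𝔪
  let q : P →ₗ[R] P ⧸ (𝔪 • ⊤ : Submodule R P) := Submodule.mkQ _
  have hq : ∀ w : P, q w = 0 ↔ (w : E) ∈ 𝔪 • P := by
    intro w
    have : 𝔪 • P = (𝔪 • ⊤ : Submodule R P).map P.subtype := by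
      rw [Submodule.map_smul'', Submodule.map_top, Submodule.range_subtype]
    rw [Submodule.mkQ_apply, Submodule.Quotient.mk_eq_zero, this]
    exact ⟨fun h => ⟨w, h, rfl⟩, fun ⟨_, h, e⟩ => Subtype.ext e ▸ h⟩
  have : Module.Finite R P := Module.Finite.iff_fg.mpr hP
  have : Module.Finite (R ⧸ 𝔪) (P ⧸ (𝔪 • ⊤ : Submodule R P)) :=
    Module.Finite.of_restrictScalars_finite R _ _
  obtain ⟨s, hs⟩ : ∃ s : Set (P ⧸ (𝔪 • ⊤ : Submodule R P)),
      LinearIndepOn (R ⧸ 𝔪) id s ∧ (q u ≠ 0 → q u ∈ s) := by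
    by_cases hu : q u = 0
    · exact ⟨∅, linearIndepOn_empty _ _, fun h => (h hu).elim⟩
    · exact ⟨{q u}, by simpa using hu, fun _ => rfl⟩
  let b := Module.Basis.extend hs.1
  have : Fintype (hs.1.extend (Set.subset_univ s)) := FiniteDimensional.fintypeBasisIndex b
  -- A set-theoretic section of `q`, altered at the class of `u` so that this class lifts to `u`
  -- itself.
  obtain ⟨f, hf⟩ : ∃ f : P ⧸ (𝔪 • ⊤ : Submodule R P) → P, (∀ v, q (f v) = v) ∧ f (q u) = u := by
    have hsurj : Function.Surjective q := Submodule.mkQ_surjective _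
    refine ⟨Function.update (Function.surjInv hsurj) (q u) u, fun v => ?_, by simp⟩
    by_cases hv : v = q u
    · subst hv; simp
    · rw [Function.update_of_ne hv]; exact Function.surjInv_eq hsurj v
  let φ := Fintype.equivFin (hs.1.extend (Set.subset_univ s))
  let c := b.reindex φ
  have key : ∀ a : Fin (Fintype.card (hs.1.extend (Set.subset_univ s))) → R,
      q (∑ j, a j • f (c j)) = ∑ j, (Ideal.Quotient.mk 𝔪 (a j)) • c j := by
    intro a
    simp only [map_sum, map_smul, hf.1]
    rfl
  refine ⟨_, fun j => (f (c j) : E), ⟨fun j => (f (c j)).2, ?_, ?_⟩, ?_⟩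
  · intro w hw
    have h1 : ∀ j, ∃ a : R, Ideal.Quotient.mk 𝔪 a = c.repr (q ⟨w, hw⟩) j := fun j =>
      Ideal.Quotient.mk_surjective _
    choose a ha using h1
    have h2 : q (⟨w, hw⟩ - ∑ j, a j • f (c j)) = 0 := by
      rw [map_sub, key]
      simp only [ha]
      rw [c.sum_repr, sub_self]
    rw [hq] at h2
    rw [Submodule.mem_sup]
    refine ⟨∑ j, a j • (f (c j) : E), Submodule.sum_mem _ fun j _ => Submodule.smul_mem _ _
      (Submodule.subset_span ⟨j, rfl⟩), _, h2, ?_⟩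
    simp
  · intro a ha j
    have h2 : q (∑ j, a j • f (c j)) = 0 := by
      rw [hq]; simpa using ha
    rw [key] at h2
    have := Fintype.linearIndependent_iff.mp c.linearIndependent _ h2 j
    rwa [Ideal.Quotient.eq_zero_iff_mem] at this
  · intro hu
    have hqu : q u ∈ s := hs.2 (by rwa [Ne, hq])
    refine ⟨φ ⟨q u, hs.1.subset_extend (Set.subset_univ s) hqu⟩, ?_⟩
    have : c (φ ⟨q u, hs.1.subset_extend (Set.subset_univ s) hqu⟩) = q u := by
      simp [c, b]
    exact congrArg Subtype.val ((congrArg f this).trans hf.2)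

theorem IsResidueBasis.le_span {J : Type*} [Fintype J] {𝔪 : Ideal R} {P : Submodule R E} {x : J → E}
    (hx : IsResidueBasis 𝔪 P x) (hP : P.FG) (h𝔪 : 𝔪 ≤ Ideal.jacobson ⊥) :
    P ≤ Submodule.span R (Set.range x) :=
  Submodule.le_of_le_smul_of_le_jacobson_bot hP h𝔪 hx.le_span_sup

theorem IsResidueBasis.exists_sum_eq {J : Type*} [Fintype J] {𝔪 : Ideal R} {P : Submodule R E}
    {x : J → E} (hx : IsResidueBasis 𝔪 P x) (hP : P.FG) (h𝔪 : 𝔪 ≤ Ideal.jacobson ⊥) {w : E}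
    (hw : w ∈ P) : ∃ a : J → R, ∑ j, a j • x j = w :=
  (Submodule.mem_span_range_iff_exists_fun R).mp (hx.le_span hP h𝔪 hw)

/-- `P` behaves like a torsion-free module over the discrete valuation ring `R / I` with
uniformizer `π`. -/
structure IsUniformizing (𝔪 I : Ideal R) (π : R) (P : Submodule R E) : Prop where
  mem : π ∈ 𝔪
  le : 𝔪 ≤ Ideal.span {π} ⊔ I
  smul_eq_zero : ∀ a ∈ I, ∀ w ∈ P, a • w = 0
  eq_zero : ∀ w ∈ P, π • w = 0 → w = 0

/-- Coefficients of a relation lie in `𝔪`, hence are multiples of `π` modulo `I`; torsion-freeness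
allows division of the relation by `π`. Iterating puts them in every `𝔪 ^ m ⊔ I`, and Krull's
intersection theorem for `R ⧸ I` finishes. -/
theorem IsResidueBasis.mem_of_sum_eq_zero [IsNoetherianRing R] {J : Type*} [Fintype J]
    {𝔪 I : Ideal R} {π : R} {P : Submodule R E} {x : J → E}
    (hx : IsResidueBasis 𝔪 P x) (h𝔪 : 𝔪 ≤ Ideal.jacobson ⊥) (h : IsUniformizing 𝔪 I π P)
    (a : J → R) (ha : ∑ j, a j • x j = 0) (j : J) : a j ∈ I := by
  have key : ∀ m : ℕ, ∀ a : J → R, ∑ j, a j • x j = 0 → ∀ j, a j ∈ 𝔪 ^ m ⊔ I := by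
    intro m
    induction m with
    | zero => intro a _ j; simp
    | succ m ih =>
      intro a ha j
      have h1 := hx.mem_of_sum_mem a (by rw [ha]; exact zero_mem _)
      have h2 : ∀ j, ∃ b, ∃ i ∈ I, b * π + i = a j := fun j => by
        obtain ⟨y, hy, i, hi, e⟩ := Submodule.mem_sup.mp (h.le (h1 j))
        obtain ⟨b, rfl⟩ := Ideal.mem_span_singleton'.mp hy
        exact ⟨b, i, hi, e⟩
      choose b i hi e using h2
      have h3 : ∑ j, b j • x j = 0 := by
        refine h.eq_zero _ (Submodule.sum_mem _ fun j _ => P.smul_mem _ (hx.mem j)) ?_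
        rw [← ha, Finset.smul_sum]
        refine Finset.sum_congr rfl fun j _ => ?_
        rw [← e, add_smul, h.smul_eq_zero _ (hi j) _ (hx.mem j), add_zero, smul_smul, mul_comm]
      obtain ⟨y, hy, i', hi', e'⟩ := Submodule.mem_sup.mp (ih b h3 j)
      rw [← e j, ← e', add_mul, add_assoc, pow_succ]
      exact Submodule.add_mem_sup (Ideal.mul_mem_mul hy h.mem)
        (I.add_mem (I.mul_mem_right _ hi') (hi j))
  have kr := Ideal.iInf_pow_smul_eq_bot_of_le_jacobson (M := R ⧸ I) 𝔪 h𝔪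
  have : Ideal.Quotient.mk I (a j) ∈ (⨅ i, 𝔪 ^ i • (⊤ : Submodule R (R ⧸ I))) := by
    rw [Submodule.mem_iInf]
    intro m
    obtain ⟨y, hy, i', hi', e'⟩ := Submodule.mem_sup.mp (key m a ha j)
    have : Ideal.Quotient.mk I (a j) = y • (1 : R ⧸ I) := by
      rw [← e', map_add, Ideal.Quotient.eq_zero_iff_mem.mpr hi', add_zero]
      change _ = Ideal.Quotient.mk I y * 1
      rw [mul_one]
    rw [this]
    exact Submodule.smul_mem_smul hy trivial
  rw [kr, Submodule.mem_bot] at this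
  exact Ideal.Quotient.eq_zero_iff_mem.mp this

/-- An element of `P` outside `𝔪 P` spans a direct summand isomorphic to `R / I`. -/
theorem exists_complement_of_notMem [IsNoetherianRing R] {𝔪 I : Ideal R} [𝔪.IsMaximal] {π : R}
    {P : Submodule R E} (hP : P.FG) (h𝔪 : 𝔪 ≤ Ideal.jacobson ⊥) (h : IsUniformizing 𝔪 I π P)
    {u : E} (hu : u ∈ P) (hu' : u ∉ 𝔪 • P) :
    (∀ a : R, a • u = 0 ↔ a ∈ I) ∧ ∃ C : Submodule R E,
      (∀ a : R, a • u ∈ C → a • u = 0) ∧ ∀ w ∈ P, ∃ a : R, w - a • u ∈ C := by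
  classical
  obtain ⟨n, x, hx, hxu⟩ := exists_isResidueBasis (𝔪 := 𝔪) hP ⟨u, hu⟩
  obtain ⟨j₀, rfl⟩ := hxu hu'
  refine ⟨fun a => ⟨fun ha => ?_, fun ha => h.smul_eq_zero a ha _ hu⟩,
    -- The complement is spanned by the other members of the family. If `a • u` lies in it, moving
    -- it across gives a relation with coefficient `-a` at `j₀`.
    Submodule.span R (Set.range fun j => if j = j₀ then 0 else x j), fun a ha => ?_,
    fun w hw => ?_⟩
  · have := hx.mem_of_sum_eq_zero h𝔪 h (Pi.single j₀ a) (by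
      simpa [Pi.single_apply, ite_smul] using ha) j₀
    simpa using this
  · obtain ⟨c, hc⟩ := (Submodule.mem_span_range_iff_exists_fun R).mp ha
    have := hx.mem_of_sum_eq_zero h𝔪 h (fun j => if j = j₀ then -a else c j) (by
      have e : ∀ j, (if j = j₀ then -a else c j) • x j =
          c j • (if j = j₀ then 0 else x j) - if j = j₀ then a • x j₀ else 0 := by
        intro j
        split_ifs with hj
        · rw [hj, neg_smul, smul_zero, zero_sub]
        · rw [sub_zero]
      simp only [e, Finset.sum_sub_distrib, hc, Finset.sum_ite_eq', Finset.mem_univ, if_true]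
      exact sub_self _) j₀
    exact h.smul_eq_zero _ (by simpa using this) _ hu
  · obtain ⟨a, ha⟩ := hx.exists_sum_eq hP h𝔪 hw
    refine ⟨a j₀, ?_⟩
    rw [← ha, ← Finset.add_sum_erase _ _ (Finset.mem_univ j₀), add_sub_cancel_left]
    refine Submodule.sum_mem _ fun j hj => Submodule.smul_mem _ _
      (Submodule.subset_span ⟨j, if_neg (Finset.ne_of_mem_erase hj)⟩)

end CommutativeAlgebra

/-! ### Augmentation, subgroup sums and coset sums in a group algebra -/

section GroupAlgebra

variable (K : Type*) [CommRing K] {G : Type*} [CommGroup G]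

/-- The augmentation `K[G] → K`. -/
def aug : MonoidAlgebra K G →ₐ[K] K := MonoidAlgebra.lift K K G 1

@[simp]
theorem aug_single (g : G) (a : K) : aug K (single g a) = a := by
  simp [aug]

variable {K} in
/-- The elements `g` of `G` with `g - 1` in the ideal `J`. -/
def unitSubgroup (J : Ideal (MonoidAlgebra K G)) : Subgroup G where
  carrier := {g | single g 1 - 1 ∈ J}
  one_mem' := by simp [← MonoidAlgebra.one_def]
  mul_mem' {a b} ha hb := by
    have : (single (a * b) 1 - 1 : MonoidAlgebra K G) =
        single a 1 * (single b 1 - 1) + (single a 1 - 1) := by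
      rw [mul_sub, MonoidAlgebra.single_mul_single, mul_one, mul_one]; abel
    change _ ∈ J
    rw [this]
    exact J.add_mem (J.mul_mem_left _ hb) ha
  inv_mem' {a} ha := by
    have : (single a⁻¹ 1 - 1 : MonoidAlgebra K G) = - (single a⁻¹ 1 * (single a 1 - 1)) := by
      rw [mul_sub, MonoidAlgebra.single_mul_single, mul_one, mul_one, inv_mul_cancel,
        ← MonoidAlgebra.one_def, neg_sub]
    change _ ∈ J
    rw [this]
    exact J.neg_mem (J.mul_mem_left _ ha)

variable {K}

theorem mem_unitSubgroup {J : Ideal (MonoidAlgebra K G)} {g : G} :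
    g ∈ unitSubgroup J ↔ single g 1 - 1 ∈ J := Iff.rfl

/-- Modulo an ideal containing every `g - 1`, each element is congruent to its augmentation. -/
theorem sub_aug_mem {J : Ideal (MonoidAlgebra K G)} (hJ : unitSubgroup J = ⊤)
    (a : MonoidAlgebra K G) : a - algebraMap K _ (aug K a) ∈ J := by
  induction a using MonoidAlgebra.induction_linear with
  | zero => simp
  | add a b ha hb => rw [map_add, map_add, add_sub_add_comm]; exact J.add_mem ha hb
  | single g r =>
    have : (single g r - algebraMap K _ (aug K (single g r)) : MonoidAlgebra K G) =
        algebraMap K _ r * (single g 1 - 1) := by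
      rw [aug_single, mul_sub, mul_one]; congr 1; simp
    rw [this]
    exact J.mul_mem_left _ (mem_unitSubgroup.mp (hJ ▸ Subgroup.mem_top g))

variable (K) [Fintype G]

open Classical in
/-- The element `Ĥ = ∑_{h ∈ H} h` of the group algebra `K G`. -/
def subgroupSum (H : Subgroup G) : MonoidAlgebra K G :=
  ∑ g : G with g ∈ H, single g 1

open Classical in
theorem coeff_subgroupSum (H : Subgroup G) (g : G) :
    (subgroupSum K H).coeff g = if g ∈ H then 1 else 0 := by
  simp [subgroupSum, MonoidAlgebra.coeff_sum, Finsupp.single_apply]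

theorem aug_subgroupSum (H : Subgroup G) : aug K (subgroupSum K H) = Nat.card H := by
  classical
  rw [subgroupSum, map_sum]
  simp [Nat.card_eq_fintype_card, Fintype.card_subtype]

variable {K}

theorem single_mul_subgroupSum {H : Subgroup G} {g : G} (hg : g ∈ H) :
    single g 1 * subgroupSum K H = subgroupSum K H := by
  ext x
  simp only [MonoidAlgebra.coeff_single_mul_apply, coeff_subgroupSum, one_mul]
  classical exact if_congr (H.mul_mem_cancel_left (H.inv_mem hg)) rfl rfl

theorem subgroupSum_mul {H : Subgroup G} {x : MonoidAlgebra K G}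
    (hx : ∀ g ∈ H, single g 1 * x = x) : subgroupSum K H * x = (Nat.card H : K) • x := by
  classical
  rw [subgroupSum, Finset.sum_mul, Finset.sum_congr rfl (g := fun _ => x) (by simpa using hx),
    Finset.sum_const, Nat.card_eq_fintype_card, Fintype.card_subtype, Nat.cast_smul_eq_nsmul]

theorem mul_subgroupSum_top (a : MonoidAlgebra K G) :
    a * subgroupSum K ⊤ = aug K a • subgroupSum K ⊤ := by
  induction a using MonoidAlgebra.induction_linear with
  | zero => simp
  | add a b ha hb => rw [map_add, add_mul, ha, hb, add_smul]
  | single g r =>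
    have : (single g r : MonoidAlgebra K G) = r • single g 1 := by simp
    rw [this, smul_mul_assoc, single_mul_subgroupSum (Subgroup.mem_top g)]
    simp

instance (H : Subgroup G) : Fintype (G ⧸ H) := Fintype.ofFinite _

variable (K) in
/-- The sum of a set of representatives of `G / H`. -/
def cosetSum (H : Subgroup G) : MonoidAlgebra K G :=
  ∑ c : G ⧸ H, single c.out 1

/-- Multiplying by `Ĥ` spreads each coefficient over its coset, so `Ĥ a = 0` forces an `a` supported
on coset representatives to vanish. -/
theorem coeff_subgroupSum_mul_cosets (H : Subgroup G) (t : G ⧸ H → K) (g : G) :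
    (subgroupSum K H * ∑ c : G ⧸ H, single c.out (t c)).coeff g = t g := by
  rw [Finset.mul_sum, MonoidAlgebra.coeff_sum, Finset.sum_apply', Finset.sum_eq_single (g : G ⧸ H)]
  · rw [MonoidAlgebra.coeff_mul_single_apply, coeff_subgroupSum, if_pos, one_mul]
    rw [mul_comm]
    exact QuotientGroup.eq.mp (QuotientGroup.out_eq' _)
  · intro c _ hc
    rw [MonoidAlgebra.coeff_mul_single_apply, coeff_subgroupSum, if_neg, zero_mul]
    intro h
    apply hc
    rw [← QuotientGroup.out_eq' c]
    exact QuotientGroup.eq.mpr (by rwa [mul_comm])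
  · simp

theorem subgroupSum_mul_cosetSum (H : Subgroup G) :
    subgroupSum K H * cosetSum K H = subgroupSum K ⊤ := by
  ext g
  rw [cosetSum, coeff_subgroupSum_mul_cosets H (fun _ => 1), coeff_subgroupSum]
  simp

end GroupAlgebra

/-! ### Subgroups of order `p` in a group of order `p²` -/

section OrderP

variable {p : ℕ} [Fact p.Prime] {G : Type*} [CommGroup G] [Fintype G]

instance : Fintype (OrderP p G) := Fintype.ofFinite _

theorem card_eq_sq (hG : Nonempty (G ≃* Multiplicative (ZMod p) × Multiplicative (ZMod p))) :
    Nat.card G = p ^ 2 := by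
  obtain ⟨e⟩ := hG
  rw [Nat.card_congr e.toEquiv, Nat.card_prod, Nat.card_congr Multiplicative.toAdd, Nat.card_zmod,
    sq]

theorem pow_eq_one (hG : Nonempty (G ≃* Multiplicative (ZMod p) × Multiplicative (ZMod p)))
    (g : G) : g ^ p = 1 := by
  obtain ⟨e⟩ := hG
  apply e.injective
  rw [map_pow, map_one]
  have : ∀ x : Multiplicative (ZMod p), x ^ p = 1 := fun x => by
    apply Multiplicative.toAdd.injective
    simp
  ext <;> simp [this]

/-- Subgroups of order `p` are maximal. Applied to `unitSubgroup J`, this reduces checking all `g -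
1 ∈ J` to `H` and one element outside it. -/
theorem eq_top_of_le_of_mem (hG : Nat.card G = p ^ 2) (H : OrderP p G) {g : G} (hg : g ∉ H.1)
    {L : Subgroup G} (hL : H.1 ≤ L) (hgL : g ∈ L) : L = ⊤ := by
  have hp : p.Prime := Fact.out
  have h1 : Nat.card L ∣ p ^ 2 := hG ▸ L.card_subgroup_dvd_card
  have h2 : Nat.card H.1 < Nat.card L := by
    refine lt_of_le_of_ne (Subgroup.card_le_of_le hL) fun h => hg ?_
    rw [Subgroup.eq_of_le_of_card_ge hL h.ge]
    exact hgL
  rw [H.2] at h2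
  obtain ⟨k, hk, e⟩ := (Nat.dvd_prime_pow hp).mp h1
  apply Subgroup.eq_top_of_card_eq
  rw [hG, e]
  interval_cases k
  · rw [pow_zero] at e; have := hp.one_lt; omega
  · rw [pow_one] at e; omega
  · rfl

theorem exists_notMem (hG : Nat.card G = p ^ 2) (H : OrderP p G) : ∃ g : G, g ∉ H.1 := by
  by_contra! h
  have h1 : H.1 = ⊤ := (Subgroup.eq_top_iff' _).mpr h
  have h2 := H.2
  have hp : p.Prime := Fact.out
  rw [h1, Subgroup.card_top, hG] at h2
  have := hp.one_lt
  nlinarith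

theorem exists_mem_notMem {H L : OrderP p G} (h : H ≠ L) : ∃ g ∈ L.1, g ∉ H.1 := by
  by_contra! h'
  exact h (Subtype.ext (Subgroup.eq_of_le_of_card_ge h' (by rw [H.2, L.2])).symm)

theorem card_quotient (hG : Nat.card G = p ^ 2) (H : OrderP p G) : Nat.card (G ⧸ H.1) = p := by
  have hp : p.Prime := Fact.out
  have := H.1.card_eq_card_quotient_mul_card_subgroup
  rw [hG, H.2, sq] at this
  exact (Nat.eq_of_mul_eq_mul_right hp.pos this).symm

section Sums

variable {K : Type*} [CommRing K]

theorem subgroupSum_mul_top (H : OrderP p G) :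
    subgroupSum K H.1 * subgroupSum K ⊤ = (p : K) • subgroupSum K ⊤ := by
  rw [subgroupSum_mul fun g _ => single_mul_subgroupSum (Subgroup.mem_top g), H.2]

theorem subgroupSum_top_mul_top (hG : Nat.card G = p ^ 2) :
    subgroupSum K (⊤ : Subgroup G) * subgroupSum K ⊤ = (p ^ 2 : K) • subgroupSum K ⊤ := by
  rw [subgroupSum_mul fun g _ => single_mul_subgroupSum (Subgroup.mem_top g), Subgroup.card_top, hG,
    Nat.cast_pow]

/-- The product `x` is fixed by `H` and by `L`, hence by `G`. So `Ĝ x` is `p² x`, while the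
augmentation of `x` makes it `p² Ĝ`; cancel `p²`. -/
theorem subgroupSum_mul_of_ne [IsDomain K] [CharZero K] (hG : Nat.card G = p ^ 2)
    {H L : OrderP p G} (h : H ≠ L) :
    subgroupSum K H.1 * subgroupSum K L.1 = subgroupSum K ⊤ := by
  obtain ⟨g, hgL, hgH⟩ := exists_mem_notMem h
  set x := subgroupSum K H.1 * subgroupSum K L.1 with hx
  let S : Subgroup G := unitSubgroup (Ideal.span {x}).annihilator
  have hS : ∀ y, y ∈ S ↔ single y 1 * x = x := fun y => by
    rw [mem_unitSubgroup, Submodule.mem_annihilator_span_singleton, sub_smul, smul_eq_mul,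
      one_smul, sub_eq_zero]
  have hT : S = ⊤ := by
    refine eq_top_of_le_of_mem hG H hgH (fun y hy => (hS y).mpr ?_) ((hS g).mpr ?_)
    · rw [hx, ← mul_assoc, single_mul_subgroupSum hy]
    · rw [hx, mul_left_comm, single_mul_subgroupSum hgL]
  have h1 : subgroupSum K ⊤ * x = (Nat.card (⊤ : Subgroup G) : K) • x :=
    subgroupSum_mul fun y _ => (hS y).mp (hT ▸ Subgroup.mem_top y)
  have h2 : subgroupSum K ⊤ * x = (p ^ 2 : K) • subgroupSum K ⊤ := by
    rw [mul_comm, mul_subgroupSum_top, hx, map_mul, aug_subgroupSum, aug_subgroupSum, H.2, L.2, sq]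
  rw [h2, Subgroup.card_top, hG, Nat.cast_pow] at h1
  have hp : (p ^ 2 : K) ≠ 0 := pow_ne_zero _ (Nat.cast_ne_zero.mpr (Fact.out : p.Prime).ne_zero)
  ext y
  have := congrArg (fun a => MonoidAlgebra.coeff a y) h1
  simp only [MonoidAlgebra.coeff_smul, Finsupp.smul_apply, smul_eq_mul] at this
  exact (mul_left_cancel₀ hp this).symm

theorem existsUnique_mem (hexp : ∀ g : G, g ^ p = 1) {g : G} (hg : g ≠ 1) :
    ∃! H : OrderP p G, g ∈ H.1 := by
  have ho : orderOf g = p := orderOf_eq_prime (hexp g) hg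
  refine ⟨⟨Subgroup.zpowers g, by rw [Nat.card_zpowers, ho]⟩, Subgroup.mem_zpowers g, ?_⟩
  intro L hL
  refine Subtype.ext (Subgroup.eq_of_le_of_card_ge ((Subgroup.zpowers_le).mpr hL) ?_).symm
  rw [L.2, Nat.card_zpowers, ho]

open Classical in
theorem card_orderP_mem (hexp : ∀ g : G, g ^ p = 1) {g : G} (hg : g ≠ 1) :
    (Finset.univ.filter fun H : OrderP p G => g ∈ H.1).card = 1 := by
  obtain ⟨H, hH, hu⟩ := existsUnique_mem hexp hg
  rw [Finset.card_eq_one]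
  exact ⟨H, by ext L; simpa using ⟨fun h => hu L h, fun h => h ▸ hH⟩⟩

/-- Double counting of the pairs `g ∈ H`: with `N` subgroups, `N p = N + (p² - 1)`. -/
theorem card_orderP (hG : Nat.card G = p ^ 2) (hexp : ∀ g : G, g ^ p = 1) :
    Fintype.card (OrderP p G) = p + 1 := by
  classical
  have h := Finset.sum_card_bipartiteAbove_eq_sum_card_bipartiteBelow
    (s := (Finset.univ : Finset (OrderP p G))) (t := (Finset.univ : Finset G))
    (fun H g => g ∈ H.1)
  have h1 : ∀ H : OrderP p G, (Finset.univ.bipartiteAbove (fun H g => g ∈ H.1) H).card = p := by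
    intro H
    rw [Finset.bipartiteAbove, ← Fintype.card_subtype, ← Nat.card_eq_fintype_card]
    exact H.2
  have h2 : ∀ g ∈ (Finset.univ.erase (1 : G)),
      (Finset.univ.bipartiteBelow (fun (H : OrderP p G) g => g ∈ H.1) g).card = 1 := fun g hg =>
    card_orderP_mem hexp (Finset.ne_of_mem_erase hg)
  rw [Finset.sum_congr rfl fun H _ => h1 H, ← Finset.add_sum_erase _ _ (Finset.mem_univ (1 : G)),
    Finset.sum_congr rfl h2] at h
  rw [Nat.card_eq_fintype_card] at hG
  have h3 : (Finset.univ.bipartiteBelow (fun (H : OrderP p G) g => g ∈ H.1) 1).card =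
      Fintype.card (OrderP p G) := by
    rw [Finset.bipartiteBelow, Finset.filter_true_of_mem (fun H _ => H.1.one_mem), Finset.card_univ]
  simp only [Finset.sum_const, smul_eq_mul, mul_one, Finset.card_erase_of_mem (Finset.mem_univ _),
    Finset.card_univ, h3, hG] at h
  have hp : 1 < p := (Fact.out : p.Prime).one_lt
  obtain ⟨q, rfl⟩ : ∃ q, p = q + 1 := ⟨p - 1, by omega⟩
  have h4 : (q + 1) ^ 2 - 1 = q * (q + 2) := by
    rw [Nat.sub_eq_iff_eq_add (Nat.one_le_pow _ _ (by omega))]; ring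
  rw [h4] at h
  have : q * Fintype.card (OrderP (q + 1) G) = q * (q + 2) := by linarith
  have := Nat.eq_of_mul_eq_mul_left (by omega) this
  omega

/-- The identity lies in all `p + 1` subgroups, every other element in exactly one. -/
theorem sum_subgroupSum (hG : Nat.card G = p ^ 2) (hexp : ∀ g : G, g ^ p = 1) :
    ∑ H : OrderP p G, subgroupSum K H.1 = subgroupSum K ⊤ + (p : MonoidAlgebra K G) := by
  classical
  ext g
  have hc : ((p : MonoidAlgebra K G)).coeff g = if g = 1 then (p : K) else 0 := by
    rw [MonoidAlgebra.natCast_def]; simp [Finsupp.single_apply, eq_comm]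
  rw [MonoidAlgebra.coeff_add, Finsupp.add_apply, hc, MonoidAlgebra.coeff_sum, Finset.sum_apply']
  simp only [coeff_subgroupSum, Subgroup.mem_top, if_true, Finset.sum_boole]
  split_ifs with h
  · subst h
    rw [Finset.filter_true_of_mem (fun H _ => H.1.one_mem), Finset.card_univ, card_orderP hG hexp]
    push_cast; ring
  · rw [card_orderP_mem hexp h]; simp

end Sums

end OrderP

/-! ### The maximal ideal of `ℤ_p G` and the Jacobson radical -/

section Local

variable (p : ℕ) [Fact p.Prime] (G : Type*) [CommGroup G]

/-- The maximal ideal of `ℤ_p G`, for a `p`-group `G`. -/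
def maxIdeal : Ideal (MonoidAlgebra ℤ_[p] G) :=
  (IsLocalRing.maximalIdeal ℤ_[p]).comap (aug ℤ_[p] : MonoidAlgebra ℤ_[p] G →ₐ[ℤ_[p]] ℤ_[p])

variable {p G}

theorem mem_maxIdeal {a : MonoidAlgebra ℤ_[p] G} : a ∈ maxIdeal p G ↔ (p : ℤ_[p]) ∣ aug ℤ_[p] a := by
  rw [maxIdeal, Ideal.mem_comap, PadicInt.maximalIdeal_eq_span_p, Ideal.mem_span_singleton]

instance : (maxIdeal p G).IsMaximal :=
  Ideal.comap_isMaximal_of_surjective _ fun a => ⟨single 1 a, aug_single _ _ _⟩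

theorem natCast_mem_maxIdeal : (p : MonoidAlgebra ℤ_[p] G) ∈ maxIdeal p G := by
  rw [mem_maxIdeal, map_natCast]

theorem single_sub_one_mem_maxIdeal (g : G) :
    (single g 1 - 1 : MonoidAlgebra ℤ_[p] G) ∈ maxIdeal p G := by
  rw [mem_maxIdeal, map_sub, aug_single, map_one, sub_self]
  exact dvd_zero _

theorem maxIdeal_le {J : Ideal (MonoidAlgebra ℤ_[p] G)} (hJ : unitSubgroup J = ⊤)
    (hp : (p : MonoidAlgebra ℤ_[p] G) ∈ J) : maxIdeal p G ≤ J := by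
  intro a ha
  obtain ⟨c, hc⟩ := mem_maxIdeal.mp ha
  have := sub_aug_mem hJ a
  rw [hc, map_mul, map_natCast] at this
  simpa using J.add_mem this (J.mul_mem_right (algebraMap ℤ_[p] _ c) hp)

variable [Fintype G]

/-- A maximal ideal `Q` lies over `p` by integrality. The quotient by `Q` has characteristic `p`,
where `(g - 1) ^ p = g ^ p - 1 = 0`, so `Q` also contains every `g - 1`. -/
theorem maxIdeal_le_jacobson (hexp : ∀ g : G, g ^ p = 1) :
    maxIdeal p G ≤ Ideal.jacobson ⊥ := by
  refine le_sInf fun Q ⟨_, hQ⟩ => ?_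
  have h1 := Ideal.isMaximal_comap_of_isIntegral_of_isMaximal (R := ℤ_[p]) Q
  have hp : (p : MonoidAlgebra ℤ_[p] G) ∈ Q := by
    have : (p : ℤ_[p]) ∈ Q.comap (algebraMap ℤ_[p] (MonoidAlgebra ℤ_[p] G)) := by
      rw [IsLocalRing.eq_maximalIdeal h1, PadicInt.maximalIdeal_eq_span_p]
      exact Ideal.mem_span_singleton_self _
    simpa using this
  refine maxIdeal_le ?_ hp
  rw [Subgroup.eq_top_iff']
  intro g
  have hc : CharP (MonoidAlgebra ℤ_[p] G ⧸ Q) p := by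
    refine (CharP.charP_iff_prime_eq_zero Fact.out).mpr ?_
    rw [← map_natCast (Ideal.Quotient.mk Q), Ideal.Quotient.eq_zero_iff_mem]
    exact hp
  rw [mem_unitSubgroup, ← Ideal.Quotient.eq_zero_iff_mem]
  apply eq_zero_of_pow_eq_zero (n := p)
  rw [map_sub, map_one, sub_pow_char, one_pow, ← map_pow, MonoidAlgebra.single_pow, hexp, one_pow,
    ← MonoidAlgebra.one_def, map_one, sub_self]

end Local

/-! ### The lattices `e_i U` as torsion-free modules over discrete valuation rings -/

section IdemSystem

variable {p : ℕ} [Fact p.Prime] {G : Type*} [CommGroup G] [Fintype G]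

/-- The multiples `p² e_i` of the idempotents `e_i`. -/
def intIdem (K : Type*) [CommRing K] : Idx p G → MonoidAlgebra K G
  | none => subgroupSum K ⊤
  | some H => (p : MonoidAlgebra K G) * subgroupSum K H.1 - subgroupSum K ⊤

/-- The annihilator of `e_i` in `ℤ_p G`. -/
def idemAnn (i : Idx p G) : Ideal (MonoidAlgebra ℤ_[p] G) :=
  (Ideal.span {intIdem ℤ_[p] i}).annihilator

theorem mem_idemAnn {i : Idx p G} {a : MonoidAlgebra ℤ_[p] G} :
    a ∈ idemAnn i ↔ a * intIdem ℤ_[p] i = 0 :=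
  Submodule.mem_annihilator_span_singleton _ _

theorem natCast_smul_eq (x : MonoidAlgebra ℤ_[p] G) : (p : ℤ_[p]) • x = p * x := by
  rw [Nat.cast_smul_eq_nsmul, nsmul_eq_mul]

theorem single_sub_one_mem_idemAnn_none (g : G) :
    single g 1 - 1 ∈ idemAnn (p := p) (none : Idx p G) := by
  rw [mem_idemAnn, sub_mul, one_mul, intIdem, single_mul_subgroupSum (Subgroup.mem_top g), sub_self]

theorem single_sub_one_mem_idemAnn_some {H : OrderP p G} {g : G} (hg : g ∈ H.1) :
    single g 1 - 1 ∈ idemAnn (some H) := by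
  rw [mem_idemAnn, sub_mul, one_mul, intIdem, mul_sub, mul_left_comm, single_mul_subgroupSum hg,
    single_mul_subgroupSum (Subgroup.mem_top g), sub_self]

theorem aug_cosetSum (hG : Nat.card G = p ^ 2) (H : OrderP p G) :
    aug ℤ_[p] (cosetSum ℤ_[p] H.1) = p := by
  rw [cosetSum, map_sum]
  simp only [aug_single, Finset.sum_const, Finset.card_univ, nsmul_eq_mul, mul_one]
  rw [← Nat.card_eq_fintype_card, card_quotient hG]

theorem cosetSum_mem_idemAnn (hG : Nat.card G = p ^ 2) (H : OrderP p G) :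
    cosetSum ℤ_[p] H.1 ∈ idemAnn (some H) := by
  rw [mem_idemAnn, intIdem, mul_sub, mul_left_comm, mul_comm _ (subgroupSum ℤ_[p] H.1),
    subgroupSum_mul_cosetSum, mul_subgroupSum_top (cosetSum _ _), aug_cosetSum hG, natCast_smul_eq, sub_self]

/-- The coset sum has augmentation `p`. As it also annihilates `e_H`, this is how `p` enters ideals
that are known to contain `ann e_H`. -/
theorem natCast_mem_of_cosetSum_mem (hG : Nat.card G = p ^ 2) (H : OrderP p G)
    {J : Ideal (MonoidAlgebra ℤ_[p] G)} (hJ : unitSubgroup J = ⊤) (h : cosetSum ℤ_[p] H.1 ∈ J) :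
    (p : MonoidAlgebra ℤ_[p] G) ∈ J := by
  have := J.sub_mem h (sub_aug_mem hJ (cosetSum ℤ_[p] H.1))
  rwa [aug_cosetSum hG, map_natCast, sub_sub_cancel] at this

variable {E : Type*} [AddCommGroup E] [Module (MonoidAlgebra ℤ_[p] G) E]

theorem subgroupSum_smul {H : Subgroup G} {w : E}
    (hw : ∀ g ∈ H, (single g 1 : MonoidAlgebra ℤ_[p] G) • w = w) :
    subgroupSum ℤ_[p] H • w = Nat.card H • w := by
  classical
  rw [subgroupSum, Finset.sum_smul, Finset.sum_congr rfl (g := fun _ => w) (by simpa using hw),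
    Finset.sum_const, Nat.card_eq_fintype_card, Fintype.card_subtype]

/-- A torsion-free `ℤ_p G`-module on which the idempotents `e_i` act. -/
structure IsIdemSystem (e : Idx p G → E →ₗ[MonoidAlgebra ℤ_[p] G] E) : Prop where
  eq_zero : ∀ x : E, (p : MonoidAlgebra ℤ_[p] G) • x = 0 → x = 0
  idem : ∀ i x, e i (e i x) = e i x
  orth : ∀ i j x, i ≠ j → e i (e j x) = 0
  sum : ∀ x, e none x + ∑ H, e (some H) x = x
  fix_none : ∀ g x, (single g 1 : MonoidAlgebra ℤ_[p] G) • e none x = e none x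
  fix_some : ∀ H : OrderP p G, ∀ g ∈ H.1, ∀ x,
    (single g 1 : MonoidAlgebra ℤ_[p] G) • e (some H) x = e (some H) x
  norm : ∀ H x, subgroupSum ℤ_[p] (⊤ : Subgroup G) • e (some H) x = 0

namespace IsIdemSystem

variable {e : Idx p G → E →ₗ[MonoidAlgebra ℤ_[p] G] E} (he : IsIdemSystem e)
include he

theorem eq_zero_sq {x : E} (h : (p ^ 2 : MonoidAlgebra ℤ_[p] G) • x = 0) : x = 0 := by
  rw [sq, mul_smul] at h
  exact he.eq_zero _ (he.eq_zero _ h)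

theorem intIdem_smul (hG : Nat.card G = p ^ 2) (i : Idx p G) (x : E) :
    intIdem ℤ_[p] i • e i x = (p ^ 2 : MonoidAlgebra ℤ_[p] G) • e i x := by
  cases i with
  | none =>
    rw [intIdem, subgroupSum_smul fun g _ => he.fix_none g x, Subgroup.card_top, hG,
      ← Nat.cast_smul_eq_nsmul (MonoidAlgebra ℤ_[p] G), Nat.cast_pow]
  | some H =>
    rw [intIdem, sub_smul, he.norm, sub_zero, mul_smul, subgroupSum_smul fun g hg =>
      he.fix_some H g hg x, H.2, ← Nat.cast_smul_eq_nsmul (MonoidAlgebra ℤ_[p] G), smul_smul, sq]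

theorem smul_eq_zero (hG : Nat.card G = p ^ 2) {i : Idx p G} {a : MonoidAlgebra ℤ_[p] G}
    (ha : a ∈ idemAnn i) (x : E) : a • e i x = 0 := by
  apply he.eq_zero_sq
  rw [smul_comm, ← he.intIdem_smul hG i x, smul_smul, mem_idemAnn.mp ha, zero_smul]

/-- Together `H` and `g` generate `G`, so `Ĝ` acts on `e_H x` as `p²`; it also acts as `0`. -/
theorem eq_zero_of_fixed (hG : Nat.card G = p ^ 2) (H : OrderP p G) {g : G} (hg : g ∉ H.1) (x : E)
    (h : (single g 1 : MonoidAlgebra ℤ_[p] G) • e (some H) x = e (some H) x) :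
    e (some H) x = 0 := by
  let S : Subgroup G := unitSubgroup (Submodule.span (MonoidAlgebra ℤ_[p] G) {e (some H) x}).annihilator
  have hS : ∀ y, y ∈ S ↔ (single y 1 : MonoidAlgebra ℤ_[p] G) • e (some H) x = e (some H) x :=
    fun y => by
      rw [mem_unitSubgroup, Submodule.mem_annihilator_span_singleton, sub_smul, one_smul,
        sub_eq_zero]
  have hT : S = ⊤ :=
    eq_top_of_le_of_mem hG H hg (fun y hy => (hS y).mpr (he.fix_some H y hy x)) ((hS g).mpr h)
  have h1 := subgroupSum_smul (H := ⊤) fun y _ => (hS y).mp (hT ▸ Subgroup.mem_top y)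
  rw [he.norm, Subgroup.card_top, hG, ← Nat.cast_smul_eq_nsmul (MonoidAlgebra ℤ_[p] G),
    Nat.cast_pow] at h1
  exact he.eq_zero_sq h1.symm

/-- The ring `Λ_(0)` is `ℤ_p` with uniformizer `p`; `Λ_(H)` is `ℤ_p[ζ_p]` with uniformizer `ζ_p -
1`, the image of `g - 1` for a suitable `g ∉ H`. -/
theorem exists_isUniformizing (hG : Nat.card G = p ^ 2) (i : Idx p G)
    (U : Submodule (MonoidAlgebra ℤ_[p] G) E) :
    ∃ π, IsUniformizing (maxIdeal p G) (idemAnn i) π (U.map (e i)) := by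
  cases i with
  | none =>
    refine ⟨p, natCast_mem_maxIdeal, maxIdeal_le ?_ ?_, ?_, fun w _ hw => he.eq_zero w hw⟩
    · rw [Subgroup.eq_top_iff']
      exact fun g => Submodule.mem_sup_right (single_sub_one_mem_idemAnn_none g)
    · exact Submodule.mem_sup_left (Ideal.mem_span_singleton_self _)
    · rintro a ha _ ⟨x, _, rfl⟩
      exact he.smul_eq_zero hG ha x
  | some H =>
    obtain ⟨g, hg⟩ := exists_notMem hG H
    have hJ : unitSubgroup (Ideal.span {(single g 1 - 1 : MonoidAlgebra ℤ_[p] G)} ⊔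
        idemAnn (some H)) = ⊤ :=
      eq_top_of_le_of_mem hG H hg
        (fun h hh => Submodule.mem_sup_right (single_sub_one_mem_idemAnn_some hh))
        (Submodule.mem_sup_left (Ideal.mem_span_singleton_self _))
    refine ⟨single g 1 - 1, single_sub_one_mem_maxIdeal g, maxIdeal_le hJ
      (natCast_mem_of_cosetSum_mem hG H hJ (Submodule.mem_sup_right (cosetSum_mem_idemAnn hG H))),
      ?_, ?_⟩
    · rintro a ha _ ⟨x, _, rfl⟩
      exact he.smul_eq_zero hG ha x
    · rintro _ ⟨x, _, rfl⟩ h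
      rw [sub_smul, one_smul, sub_eq_zero] at h
      exact he.eq_zero_of_fixed hG H hg x h

theorem exists_complement (hG : Nat.card G = p ^ 2) (hexp : ∀ g : G, g ^ p = 1) (i : Idx p G)
    {U : Submodule (MonoidAlgebra ℤ_[p] G) E} (hU : U.FG) {u : E} (hu : u ∈ U)
    (hui : u ∈ U.map (e i)) (hu' : u ∉ maxIdeal p G • U.map (e i)) :
    (∀ a : MonoidAlgebra ℤ_[p] G, a • u = 0 ↔ a ∈ idemAnn i) ∧
      ∃ W : Submodule (MonoidAlgebra ℤ_[p] G) E,
      (∀ a : MonoidAlgebra ℤ_[p] G, a • u ∈ W → a • u = 0) ∧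
      ∀ w ∈ U, ∃ a : MonoidAlgebra ℤ_[p] G, w - a • u ∈ W := by
  have : IsNoetherianRing (MonoidAlgebra ℤ_[p] G) := IsNoetherianRing.of_finite ℤ_[p] _
  obtain ⟨π, hπ⟩ := he.exists_isUniformizing hG i U
  obtain ⟨h1, C, h2, h3⟩ :=
    exists_complement_of_notMem (hU.map (e i)) (maxIdeal_le_jacobson hexp) hπ hui hu'
  have h4 : e i u = u := by obtain ⟨x, -, rfl⟩ := hui; exact he.idem i x
  -- Since `e_i u = u`, a complement of `u` inside `e_i U` pulls back along `e_i` to a complement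
  -- inside `U`.
  refine ⟨h1, C.comap (e i), fun a ha => h2 a ?_, fun w hw => ?_⟩
  · simpa [h4] using ha
  · obtain ⟨a, ha⟩ := h3 (e i w) (Submodule.mem_map_of_mem hw)
    exact ⟨a, by simpa [h4] using ha⟩

/-- Trivial action carries `(g - 1) U_(i)` into `U`, so only `p` needs care. For `i = H` the coset
sum kills `U_(H)` and is congruent to `p`; for `i = 0` an element is a sum of elements of the
`U_(H)` modulo `U`. -/
theorem maxIdeal_smul_le (hG : Nat.card G = p ^ 2)
    {U : Submodule (MonoidAlgebra ℤ_[p] G) E}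
    (hT : ∀ i g, ∀ x ∈ U.map (e i), (single g 1 : MonoidAlgebra ℤ_[p] G) • x - x ∈ U)
    (hS : ∀ x ∈ U.map (e none), ∃ w : OrderP p G → E, (∀ H, w H ∈ U.map (e (some H))) ∧
      x - ∑ H, w H ∈ U) (i : Idx p G) : maxIdeal p G • U.map (e i) ≤ U := by
  have hJ : ∀ i, unitSubgroup (U.colon (U.map (e i) : Set E)) = ⊤ := fun i => by
    rw [Subgroup.eq_top_iff']
    intro g
    rw [mem_unitSubgroup, Submodule.mem_colon]
    intro x hx
    rw [sub_smul, one_smul]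
    exact hT i g x hx
  have hp : ∀ H, ∀ x ∈ U.map (e (some H)), (p : MonoidAlgebra ℤ_[p] G) • x ∈ U := fun H => by
    refine Submodule.mem_colon.mp (natCast_mem_of_cosetSum_mem hG H (hJ (some H)) ?_)
    rw [Submodule.mem_colon]
    rintro _ ⟨x, _, rfl⟩
    rw [he.smul_eq_zero hG (cosetSum_mem_idemAnn hG H)]
    exact U.zero_mem
  rw [Submodule.smul_le]
  intro r hr x hx
  refine Submodule.mem_colon.mp (maxIdeal_le (hJ i) ?_ hr) x hx
  rw [Submodule.mem_colon]
  cases i with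
  | some H => exact hp H
  | none =>
    intro x hx
    obtain ⟨w, hw, hxw⟩ := hS x hx
    have : (p : MonoidAlgebra ℤ_[p] G) • x = p • (x - ∑ H, w H) + ∑ H, p • w H := by
      rw [← Finset.smul_sum, ← smul_add, sub_add_cancel]
      exact Nat.cast_smul_eq_nsmul _ _ _
    rw [this]
    refine U.add_mem (U.nsmul_mem hxw p) (U.sum_mem fun H _ => ?_)
    rw [← Nat.cast_smul_eq_nsmul (MonoidAlgebra ℤ_[p] G)]
    exact hp H _ (hw H)

end IsIdemSystem

end IdemSystem

/-! ### Building a permuted basis from the diagram -/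

section Generators

variable {p : ℕ} [Fact p.Prime] {G : Type*} [CommGroup G] [Fintype G]

section

variable {E : Type*} [AddCommGroup E] [Module (MonoidAlgebra ℤ_[p] G) E]
  {e : Idx p G → E →ₗ[MonoidAlgebra ℤ_[p] G] E}

theorem IsIdemSystem.exists_generators (he : IsIdemSystem e) (hG : Nat.card G = p ^ 2)
    (hexp : ∀ g : G, g ^ p = 1) {U : Submodule (MonoidAlgebra ℤ_[p] G) E} (hU : U.FG)
    (hred : ∀ i, U ⊓ U.map (e i) ≤ maxIdeal p G • U.map (e i))
    (hT : ∀ i g, ∀ x ∈ U.map (e i), (single g 1 : MonoidAlgebra ℤ_[p] G) • x - x ∈ U)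
    (h0 : ∀ H, ∀ x ∈ U.map (e (some H)), ∃ y ∈ U.map (e none), x - y ∈ U)
    (hS : ∀ x ∈ U.map (e none), ∃ w : OrderP p G → E, (∀ H, w H ∈ U.map (e (some H))) ∧
      x - ∑ H, w H ∈ U)
    (hI : ∀ w : OrderP p G → E, (∀ H, w H ∈ U.map (e (some H))) → ∑ H, w H ∈ U → ∀ H, w H ∈ U) :
    ∃ (n : OrderP p G → ℕ) (z : (Σ H, Fin (n H)) → E), (∀ s, z s ∈ U) ∧
      (∀ s, ∀ g ∈ s.1.1, (single g 1 : MonoidAlgebra ℤ_[p] G) • z s = z s) ∧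
      U ≤ Submodule.span (MonoidAlgebra ℤ_[p] G) (Set.range z) ∧
      ∀ a : (Σ H, Fin (n H)) → MonoidAlgebra ℤ_[p] G, ∑ s, a s • z s = 0 →
        ∀ s, subgroupSum ℤ_[p] s.1.1 * a s = 0 := by
  have : IsNoetherianRing (MonoidAlgebra ℤ_[p] G) := IsNoetherianRing.of_finite ℤ_[p] _
  have hjac := maxIdeal_le_jacobson (p := p) hexp
  have hle := he.maxIdeal_smul_le hG hT hS
  have hFG : ∀ i, (U.map (e i)).FG := fun i => hU.map (e i)
  have hfix : ∀ i, ∀ x ∈ U.map (e i), e i x = x := by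
    rintro i _ ⟨x, _, rfl⟩; exact he.idem i x
  have hzero : ∀ i j, i ≠ j → ∀ x ∈ U.map (e j), e i x = 0 := by
    rintro i j hij _ ⟨x, _, rfl⟩; exact he.orth i j x hij
  -- No particular vector has to belong to the family, so `0` is passed as the prescribed element.
  choose n x hx _ using fun H : OrderP p G =>
    exists_isResidueBasis (𝔪 := maxIdeal p G) (hFG (some H)) 0
  choose y hy hxy using fun s : Σ H, Fin (n H) => h0 s.1 _ ((hx s.1).mem s.2)
  -- Modulo `U` the `y s` agree with the `x s`. Generation comes from `V_(0) ⊆ ∑ V_(H)` and `U ∩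
  -- U_(0) ⊆ 𝔪 U_(0)`; independence from `𝔪 U_(0) ⊆ U`, directness of the sum and `U ∩ U_(H) ⊆ 𝔪
  -- U_(H)`.
  have hyb : IsResidueBasis (maxIdeal p G) (U.map (e none)) y := by
    refine ⟨hy, fun v hv => ?_, fun a ha => ?_⟩
    · obtain ⟨w, hw, hvw⟩ := hS v hv
      choose a ha using fun H => (hx H).exists_sum_eq (hFG (some H)) hjac (hw H)
      have h1 : ∑ H, w H = ∑ s : Σ H, Fin (n H), a s.1 s.2 • x s.1 s.2 := by
        rw [Fintype.sum_sigma]; exact Finset.sum_congr rfl fun H _ => (ha H).symm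
      have h2 : v - ∑ s : Σ H, Fin (n H), a s.1 s.2 • y s ∈ maxIdeal p G • U.map (e none) := by
        refine hred none ⟨?_, ?_⟩
        · have : v - ∑ s : Σ H, Fin (n H), a s.1 s.2 • y s = (v - ∑ H, w H) +
              ∑ s : Σ H, Fin (n H), a s.1 s.2 • (x s.1 s.2 - y s) := by
            simp only [smul_sub, Finset.sum_sub_distrib, h1]; abel
          rw [this]
          exact U.add_mem hvw (U.sum_mem fun s _ => U.smul_mem _ (hxy s))
        · exact Submodule.sub_mem _ hv
            (Submodule.sum_mem _ fun s _ => Submodule.smul_mem _ _ (hy s))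
      rw [← sub_add_cancel v (∑ s : Σ H, Fin (n H), a s.1 s.2 • y s), add_comm]
      exact Submodule.add_mem_sup (Submodule.sum_mem _ fun s _ => Submodule.smul_mem _ _
        (Submodule.subset_span ⟨s, rfl⟩)) h2
    · have h1 : ∑ H, ∑ j, a ⟨H, j⟩ • x H j ∈ U := by
        have : ∑ H, ∑ j, a ⟨H, j⟩ • x H j =
            ∑ s, a s • y s + ∑ s : Σ H, Fin (n H), a s • (x s.1 s.2 - y s) := by
          simp only [smul_sub, Finset.sum_sub_distrib]
          rw [add_sub_cancel, Fintype.sum_sigma]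
        rw [this]
        exact U.add_mem (hle _ ha) (U.sum_mem fun s _ => U.smul_mem _ (hxy s))
      have h2 : ∀ H, ∑ j, a ⟨H, j⟩ • x H j ∈ U.map (e (some H)) := fun H =>
        Submodule.sum_mem _ fun j _ => Submodule.smul_mem _ _ ((hx H).mem j)
      rintro ⟨H, j⟩
      exact (hx H).mem_of_sum_mem (fun j => a ⟨H, j⟩) (hred _ ⟨hI _ h2 h1 H, h2 H⟩) j
  have hHfix : ∀ s : Σ H, Fin (n H), ∀ g ∈ s.1.1,
      (single g 1 : MonoidAlgebra ℤ_[p] G) • (x s.1 s.2 - y s) = x s.1 s.2 - y s := by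
    intro s g hg
    rw [smul_sub, ← hfix _ _ ((hx s.1).mem s.2), ← hfix _ _ (hy s), he.fix_some _ g hg,
      he.fix_none]
  -- The coset sum of `G / H` kills `x s` and acts on the `G`-fixed `y s` as `p`, so it sends `x s -
  -- y s` to `-p • y s`.
  have h𝔪y : ∀ s, ∀ r ∈ maxIdeal p G, r • y s ∈
      Submodule.span (MonoidAlgebra ℤ_[p] G) (Set.range fun s => x s.1 s.2 - y s) := by
    intro s
    set S := Submodule.span (MonoidAlgebra ℤ_[p] G) (Set.range fun s => x s.1 s.2 - y s)
    have hJ : unitSubgroup (S.colon {y s}) = ⊤ := by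
      rw [Subgroup.eq_top_iff']
      intro g
      rw [mem_unitSubgroup, Submodule.mem_colon_singleton, sub_smul, one_smul, ← hfix _ _ (hy s),
        he.fix_none, sub_self]
      exact S.zero_mem
    intro r hr
    refine Submodule.mem_colon_singleton.mp (maxIdeal_le hJ ?_ hr)
    refine natCast_mem_of_cosetSum_mem hG s.1 hJ (Submodule.mem_colon_singleton.mpr ?_)
    have h1 : cosetSum ℤ_[p] s.1.1 • x s.1 s.2 = 0 := by
      rw [← hfix _ _ ((hx s.1).mem s.2)]
      exact he.smul_eq_zero hG (cosetSum_mem_idemAnn hG s.1) _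
    have h2 := S.neg_mem (S.smul_mem (cosetSum ℤ_[p] s.1.1) (Submodule.subset_span ⟨s, rfl⟩))
    simpa [smul_sub, h1] using h2
  refine ⟨n, fun s => x s.1 s.2 - y s, hxy, hHfix, fun u hu => ?_, fun a ha s => ?_⟩
  · choose a ha using fun H => (hx H).exists_sum_eq (hFG (some H)) hjac
      (Submodule.mem_map_of_mem (f := e (some H)) hu)
    -- With `a` read off from the components `e_H u`, subtraction cancels these components and
    -- leaves an element of `U ∩ U_(0)`.
    have h1 : u - ∑ s : Σ H, Fin (n H), a s.1 s.2 • (x s.1 s.2 - y s) =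
        e none u + ∑ s : Σ H, Fin (n H), a s.1 s.2 • y s := by
      conv_lhs => rw [← he.sum u]
      simp only [smul_sub, Finset.sum_sub_distrib]
      rw [Fintype.sum_sigma (fun s : Σ H, Fin (n H) => a s.1 s.2 • x s.1 s.2)]
      simp only [ha]
      abel
    have h2 : u - ∑ s : Σ H, Fin (n H), a s.1 s.2 • (x s.1 s.2 - y s) ∈
        maxIdeal p G • U.map (e none) := by
      refine hred none ⟨U.sub_mem hu (U.sum_mem fun s _ => U.smul_mem _ (hxy s)), ?_⟩
      rw [h1]
      exact Submodule.add_mem _ (Submodule.mem_map_of_mem hu)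
        (Submodule.sum_mem _ fun s _ => Submodule.smul_mem _ _ (hy s))
    have h3 : maxIdeal p G • U.map (e none) ≤
        Submodule.span (MonoidAlgebra ℤ_[p] G) (Set.range fun s => x s.1 s.2 - y s) := by
      refine (Submodule.smul_mono le_rfl (hyb.le_span (hFG none) hjac)).trans ?_
      rw [Submodule.smul_le]
      intro r hr v hv
      obtain ⟨c, rfl⟩ := (Submodule.mem_span_range_iff_exists_fun _).mp hv
      rw [Finset.smul_sum]
      refine Submodule.sum_mem _ fun s _ => ?_
      rw [smul_comm]
      exact Submodule.smul_mem _ _ (h𝔪y s r hr)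
    rw [← sub_add_cancel u (∑ s : Σ H, Fin (n H), a s.1 s.2 • (x s.1 s.2 - y s))]
    exact Submodule.add_mem _ (h3 h2) (Submodule.sum_mem _ fun s _ => Submodule.smul_mem _ _
      (Submodule.subset_span ⟨s, rfl⟩))
  · have h1 : ∑ s, a s • y s = 0 := by
      have := congrArg (e none) ha
      rw [map_sum, map_zero] at this
      rw [← neg_eq_zero, ← this, ← Finset.sum_neg_distrib]
      refine Finset.sum_congr rfl fun s _ => ?_
      rw [map_smul, map_sub, hfix _ _ (hy s), hzero _ _ (by simp) _ ((hx s.1).mem s.2), zero_sub,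
        smul_neg]
    obtain ⟨H, j⟩ := s
    have h2 : ∑ j, a ⟨H, j⟩ • x H j = 0 := by
      have := congrArg (e (some H)) ha
      rw [map_sum, map_zero, Fintype.sum_sigma, Finset.sum_eq_single H] at this
      · rw [← this]
        refine Finset.sum_congr rfl fun j _ => ?_
        rw [map_smul, map_sub, hfix _ _ ((hx H).mem j), hzero _ _ (by simp) _ (hy _), sub_zero]
      · intro L _ hL
        refine Finset.sum_eq_zero fun j _ => ?_
        rw [map_smul, map_sub, hzero _ _ (by simpa using hL.symm) _ ((hx L).mem j),
          hzero _ _ (by simp) _ (hy _), sub_zero, smul_zero]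
      · simp
    obtain ⟨π₀, hπ₀⟩ := he.exists_isUniformizing hG none U
    obtain ⟨π, hπ⟩ := he.exists_isUniformizing hG (some H) U
    -- Annihilating both `e_0` and `e_H` means `Ĝ a = 0` and `(p Ĥ - Ĝ) a = 0`; hence `p Ĥ a = 0`,
    -- and `p` cancels.
    have h3 : a ⟨H, j⟩ ∈ idemAnn none := hyb.mem_of_sum_eq_zero hjac hπ₀ a h1 ⟨H, j⟩
    have h4 : a ⟨H, j⟩ ∈ idemAnn (some H) :=
      (hx H).mem_of_sum_eq_zero hjac hπ (fun j => a ⟨H, j⟩) h2 j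
    rw [mem_idemAnn] at h3 h4
    simp only [intIdem] at h3 h4
    rw [mul_sub, h3, sub_zero, mul_left_comm, ← natCast_smul_eq, mul_comm] at h4
    have hp : (p : ℤ_[p]) ≠ 0 := Nat.cast_ne_zero.mpr (Fact.out : p.Prime).ne_zero
    ext g
    have := congrArg (fun b => MonoidAlgebra.coeff b g) h4
    simpa [hp] using this

end

/-- The basis consists of the translates of each `z s` by representatives of `G ⧸ H s`. A
`ℤ_p`-relation among them is a group-algebra relation whose coefficients are supported on
representatives, and these are recovered from their products with `Ĥ`. -/
theorem exists_permuted_basis {M : Type*} [AddCommGroup M] [Module ℤ_[p] M]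
    [Module (MonoidAlgebra ℤ_[p] G) M] [IsScalarTower ℤ_[p] (MonoidAlgebra ℤ_[p] G) M]
    {S : Type*} [Fintype S] (H : S → Subgroup G) (z : S → M)
    (hfix : ∀ s, ∀ g ∈ H s, (single g 1 : MonoidAlgebra ℤ_[p] G) • z s = z s)
    (hspan : ⊤ ≤ Submodule.span (MonoidAlgebra ℤ_[p] G) (Set.range z))
    (hind : ∀ a : S → MonoidAlgebra ℤ_[p] G, ∑ s, a s • z s = 0 →
        ∀ s, subgroupSum ℤ_[p] (H s) * a s = 0) :
    ∃ (n : ℕ) (b : Module.Basis (Fin n) ℤ_[p] M), ∀ (g : G) (i : Fin n), ∃ j : Fin n,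
      (single g 1 : MonoidAlgebra ℤ_[p] G) • b i = b j := by
  let v : (Σ s, G ⧸ H s) → M := fun q => (single q.2.out 1 : MonoidAlgebra ℤ_[p] G) • z q.1
  have hv : ∀ s (g : G), (single g 1 : MonoidAlgebra ℤ_[p] G) • z s = v ⟨s, g⟩ := by
    intro s g
    obtain ⟨h, hh⟩ := QuotientGroup.mk_out_eq_mul (H s) g
    have h1 : (single (g * h) 1 : MonoidAlgebra ℤ_[p] G) = single g 1 * single (h : G) 1 := by simp
    simp only [v]
    rw [hh, h1, mul_smul, hfix s h h.2]
  have hli : LinearIndependent ℤ_[p] v := by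
    rw [Fintype.linearIndependent_iff]
    rintro t ht ⟨s, c⟩
    have h1 : ∑ s, (∑ c : G ⧸ H s, (single c.out (t ⟨s, c⟩) : MonoidAlgebra ℤ_[p] G)) • z s = 0 := by
      rw [← ht, Fintype.sum_sigma]
      refine Finset.sum_congr rfl fun s _ => ?_
      rw [Finset.sum_smul]
      refine Finset.sum_congr rfl fun c _ => ?_
      simp only [v]
      rw [← smul_assoc]
      simp
    have h2 := congrArg (fun b => MonoidAlgebra.coeff b c.out) (hind _ h1 s)
    simp only [coeff_subgroupSum_mul_cosets (H s) (fun c => t ⟨s, c⟩)] at h2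
    simpa using h2
  have hsp : ⊤ ≤ Submodule.span ℤ_[p] (Set.range v) := by
    intro m _
    obtain ⟨a, rfl⟩ := (Submodule.mem_span_range_iff_exists_fun _).mp (hspan (x := m) trivial)
    refine Submodule.sum_mem _ fun s _ => ?_
    induction a s using MonoidAlgebra.induction_linear with
    | zero => simp
    | add a b ha hb => rw [add_smul]; exact Submodule.add_mem _ ha hb
    | single g r =>
      have h1 : (single g r : MonoidAlgebra ℤ_[p] G) = r • single g 1 := by simp
      rw [h1, smul_assoc, hv]
      exact Submodule.smul_mem _ _ (Submodule.subset_span ⟨_, rfl⟩)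
  let φ := Fintype.equivFin (Σ s, G ⧸ H s)
  refine ⟨_, (Module.Basis.mk hli hsp).reindex φ, fun g i => ?_⟩
  obtain ⟨⟨s, c⟩, rfl⟩ := φ.surjective i
  refine ⟨φ ⟨s, (g * c.out : G)⟩, ?_⟩
  simp only [Module.Basis.reindex_apply, Equiv.symm_apply_apply, Module.Basis.mk_apply]
  rw [← hv]
  simp only [v]
  rw [smul_smul, MonoidAlgebra.single_mul_single, mul_one]

end Generators

/-! ### Orbits of a permuted basis as direct summands -/

section PermutationModule

variable {p : ℕ} [Fact p.Prime] {G : Type*} [CommGroup G]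
  {M : Type*} [AddCommGroup M] [Module ℤ_[p] M] [Module (MonoidAlgebra ℤ_[p] G) M]
  [IsScalarTower ℤ_[p] (MonoidAlgebra ℤ_[p] G) M]
  {n : Type*} (b : Module.Basis n ℤ_[p] M)

theorem mem_of_basis_mem (S : Submodule (MonoidAlgebra ℤ_[p] G) M) (h : ∀ i, b i ∈ S) (x : M) :
    x ∈ S := by
  have : ⊤ ≤ S.restrictScalars ℤ_[p] := by
    rw [← b.span_eq, Submodule.span_le]
    rintro _ ⟨i, rfl⟩
    exact h i
  exact this trivial

theorem linearMap_ext_basis {E : Type*} [AddCommGroup E] [Module (MonoidAlgebra ℤ_[p] G) E]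
    {f g : M →ₗ[MonoidAlgebra ℤ_[p] G] E} (h : ∀ i, f (b i) = g (b i)) : f = g :=
  LinearMap.ext fun x => mem_of_basis_mem b (LinearMap.eqLocus f g) h x

variable [MulAction G n]

section

variable (hb : ∀ (g : G) i, (single g 1 : MonoidAlgebra ℤ_[p] G) • b i = b (g • i))

open Classical in
/-- The projection of a permutation module onto the span of a union of orbits. -/
def orbitProj (P : n → Prop) (hP : ∀ (g : G) i, P (g • i) ↔ P i) : M →ₗ[MonoidAlgebra ℤ_[p] G] M :=
  MonoidAlgebra.equivariantOfLinearOfComm (b.constr ℤ_[p] fun i => if P i then b i else 0)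
    fun g v => by
      have hv : v ∈ Submodule.span ℤ_[p] (Set.range b) := b.mem_span v
      induction hv using Submodule.span_induction with
      | zero => simp
      | add x y _ _ hx hy => simp only [smul_add, map_add, hx, hy]
      | smul r x _ hx => rw [smul_comm, map_smul, hx, map_smul, smul_comm]
      | mem x hx =>
        obtain ⟨i, rfl⟩ := hx
        rw [hb, Module.Basis.constr_basis, Module.Basis.constr_basis]
        by_cases h : P i
        · rw [if_pos h, if_pos ((hP g i).mpr h), hb]
        · rw [if_neg h, if_neg (mt (hP g i).mp h), smul_zero]

variable {P : n → Prop} (hP : ∀ (g : G) i, P (g • i) ↔ P i)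

theorem orbitProj_basis_of_pos {i : n} (h : P i) : orbitProj b hb P hP (b i) = b i := by
  rw [orbitProj, MonoidAlgebra.equivariantOfLinearOfComm_apply, Module.Basis.constr_basis, if_pos h]

theorem orbitProj_basis_of_neg {i : n} (h : ¬ P i) : orbitProj b hb P hP (b i) = 0 := by
  rw [orbitProj, MonoidAlgebra.equivariantOfLinearOfComm_apply, Module.Basis.constr_basis, if_neg h]

include hb in
theorem exists_isCompl_span_basis (i : n) : ∃ W : Submodule (MonoidAlgebra ℤ_[p] G) M,
    IsCompl (Submodule.span (MonoidAlgebra ℤ_[p] G) {b i}) W := by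
  have hP : ∀ (g : G) j, g • j ∈ MulAction.orbit G i ↔ j ∈ MulAction.orbit G i := fun g j =>
    ⟨fun h => by simpa using MulAction.mem_orbit_of_mem_orbit g⁻¹ h,
      MulAction.mem_orbit_of_mem_orbit g⟩
  -- Its image is the span of the orbit of `b i`, and its kernel is the required complement.
  let f := orbitProj b hb (fun j => j ∈ MulAction.orbit G i) hP
  refine ⟨LinearMap.ker f, LinearMap.IsProj.isCompl (f := f) ⟨fun x => ?_, fun x hx => ?_⟩⟩
  · refine mem_of_basis_mem b
      (Submodule.comap f (Submodule.span (MonoidAlgebra ℤ_[p] G) {b i})) (fun j => ?_) x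
    rw [Submodule.mem_comap]
    by_cases h : j ∈ MulAction.orbit G i
    · rw [orbitProj_basis_of_pos b hb hP h]
      obtain ⟨g, rfl⟩ := h
      rw [← hb]
      exact Submodule.smul_mem _ _ (Submodule.mem_span_singleton_self _)
    · rw [orbitProj_basis_of_neg b hb hP h]
      exact Submodule.zero_mem _
  · obtain ⟨a, rfl⟩ := Submodule.mem_span_singleton.mp hx
    rw [map_smul, orbitProj_basis_of_pos b hb hP (MulAction.mem_orbit_self i)]

include hb in
theorem repr_smul_basis {i : n} (hi : MulAction.stabilizer G i = ⊥) (a : MonoidAlgebra ℤ_[p] G)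
    (h : G) : b.repr (a • b i) (h • i) = a.coeff h := by
  classical
  induction a using MonoidAlgebra.induction_linear with
  | zero => simp
  | add x y hx hy => rw [add_smul, map_add, Finsupp.add_apply, hx, hy]; rfl
  | single g r =>
    have h1 : (single g r : MonoidAlgebra ℤ_[p] G) = r • single g 1 := by simp
    have h2 : g • i = h • i ↔ g = h := by
      refine ⟨fun e => ?_, fun e => by rw [e]⟩
      have : h⁻¹ * g ∈ MulAction.stabilizer G i := by
        rw [MulAction.mem_stabilizer_iff, mul_smul, e, inv_smul_smul]
      rw [hi, Subgroup.mem_bot, inv_mul_eq_one] at this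
      exact this.symm
    rw [h1, smul_assoc, hb, map_smul b.repr, Module.Basis.repr_self]
    simp [Finsupp.single_apply, h2]

include hb in
theorem smul_basis_eq_zero_iff_of_stabilizer_eq_bot {i : n} (hi : MulAction.stabilizer G i = ⊥)
    (a : MonoidAlgebra ℤ_[p] G) : a • b i = 0 ↔ a = 0 := by
  refine ⟨fun h => ?_, fun h => by rw [h, zero_smul]⟩
  ext g
  rw [← repr_smul_basis b hb hi, h]
  simp

include hb in
theorem smul_basis_eq_zero_iff_of_stabilizer_eq_top {i : n} (hi : MulAction.stabilizer G i = ⊤)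
    (a : MonoidAlgebra ℤ_[p] G) : a • b i = 0 ↔ aug ℤ_[p] a = 0 := by
  have hJ : unitSubgroup (Submodule.span (MonoidAlgebra ℤ_[p] G) {b i}).annihilator = ⊤ := by
    rw [Subgroup.eq_top_iff']
    intro g
    have hg : g • i = i := MulAction.mem_stabilizer_iff.mp (hi ▸ Subgroup.mem_top g)
    rw [mem_unitSubgroup, Submodule.mem_annihilator_span_singleton, sub_smul, one_smul, hb, hg,
      sub_self]
  have h1 := sub_aug_mem hJ a
  rw [Submodule.mem_annihilator_span_singleton, sub_smul, sub_eq_zero, algebraMap_smul] at h1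
  rw [h1]
  refine ⟨fun h => ?_, fun h => by rw [h, zero_smul]⟩
  have := congrArg (fun x => b.repr x i) h
  simpa using this

end

end PermutationModule

/-! ### The diagram of a permutation module with stabilizers of order `p` -/

section Forward

variable {p : ℕ} [Fact p.Prime] {G : Type*} [CommGroup G] [Fintype G]
  {M : Type*} [AddCommGroup M] [Module ℤ_[p] M] [Module (MonoidAlgebra ℤ_[p] G) M]
  [IsScalarTower ℤ_[p] (MonoidAlgebra ℤ_[p] G) M]
  {n : Type*} (b : Module.Basis n ℤ_[p] M) [MulAction G n]
  (hb : ∀ (g : G) i, (single g 1 : MonoidAlgebra ℤ_[p] G) • b i = b (g • i))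
  {E : Type*} [AddCommGroup E] [Module (MonoidAlgebra ℤ_[p] G) E]
  {e : Idx p G → E →ₗ[MonoidAlgebra ℤ_[p] G] E} (he : IsIdemSystem e)
  (hform : ∀ i x, (p ^ 2 : MonoidAlgebra ℤ_[p] G) • e i x = intIdem ℤ_[p] i • x)
  (ι : M →ₗ[MonoidAlgebra ℤ_[p] G] E)
  (S : n → OrderP p G) (hS : ∀ j, MulAction.stabilizer G j = (S j).1)

include hS in
theorem stabilizer_smul_eq (g : G) (j : n) : S (g • j) = S j := by
  apply Subtype.ext
  rw [← hS, ← hS]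
  ext h
  rw [MulAction.mem_stabilizer_iff, MulAction.mem_stabilizer_iff, smul_smul, mul_comm, mul_smul,
    smul_left_cancel_iff]

/-- The projection onto the span of the basis elements with stabilizer `H`. -/
def stabProj (H : OrderP p G) : M →ₗ[MonoidAlgebra ℤ_[p] G] M :=
  orbitProj b hb (fun j => S j = H) fun g j => by rw [stabilizer_smul_eq S hS]

theorem stabProj_basis_self (j : n) : stabProj b hb S hS (S j) (b j) = b j :=
  orbitProj_basis_of_pos b hb _ rfl

theorem stabProj_basis_of_ne {H : OrderP p G} {j : n} (h : S j ≠ H) :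
    stabProj b hb S hS H (b j) = 0 :=
  orbitProj_basis_of_neg b hb _ h

theorem sum_stabProj (x : M) : ∑ H, stabProj b hb S hS H x = x := by
  have : ∑ H, stabProj b hb S hS H = LinearMap.id := linearMap_ext_basis b fun j => by
    rw [LinearMap.sum_apply, Finset.sum_eq_single (S j) (fun H _ h =>
      stabProj_basis_of_ne b hb S hS h.symm) (by simp), stabProj_basis_self]
    rfl
  rw [← LinearMap.sum_apply, this, LinearMap.id_apply]

theorem stabProj_stabProj_self (H : OrderP p G) (x : M) :
    stabProj b hb S hS H (stabProj b hb S hS H x) = stabProj b hb S hS H x := by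
  refine LinearMap.congr_fun (linearMap_ext_basis (f := stabProj b hb S hS H ∘ₗ
    stabProj b hb S hS H) b fun j => ?_) x
  rw [LinearMap.comp_apply]
  by_cases h : S j = H
  · subst h; rw [stabProj_basis_self, stabProj_basis_self]
  · rw [stabProj_basis_of_ne b hb S hS h, map_zero]

theorem stabProj_stabProj_of_ne {H L : OrderP p G} (hHL : H ≠ L) (x : M) :
    stabProj b hb S hS H (stabProj b hb S hS L x) = 0 := by
  refine LinearMap.congr_fun (linearMap_ext_basis (f := stabProj b hb S hS H ∘ₗ
    stabProj b hb S hS L) (g := 0) b fun j => ?_) x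
  rw [LinearMap.comp_apply, LinearMap.zero_apply]
  by_cases h : S j = L
  · subst h; rw [stabProj_basis_self, stabProj_basis_of_ne b hb S hS hHL.symm]
  · rw [stabProj_basis_of_ne b hb S hS h, map_zero]

include hb hS in
theorem subgroupSum_smul_basis (j : n) :
    subgroupSum ℤ_[p] (S j).1 • b j = (p : MonoidAlgebra ℤ_[p] G) • b j := by
  rw [subgroupSum_smul fun g hg => ?_, (S j).2, Nat.cast_smul_eq_nsmul]
  rw [← hS, MulAction.mem_stabilizer_iff] at hg
  rw [hb, hg]

-- It suffices to compare both sides on basis elements, after multiplication by `p²` so that only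
-- integral group-algebra elements act.
include he hform in
theorem idem_some_apply (hG : Nat.card G = p ^ 2) (H : OrderP p G) (x : M) :
    e (some H) (ι x) = ι (stabProj b hb S hS H x) - e none (ι (stabProj b hb S hS H x)) := by
  refine LinearMap.congr_fun (linearMap_ext_basis (f := e (some H) ∘ₗ ι)
    (g := ι ∘ₗ stabProj b hb S hS H - e none ∘ₗ ι ∘ₗ stabProj b hb S hS H) b fun j => ?_) x
  simp only [LinearMap.comp_apply, LinearMap.sub_apply]
  have hj := subgroupSum_smul_basis b hb S hS j
  rw [← sub_eq_zero]
  apply he.eq_zero_sq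
  by_cases h : S j = H
  · subst h
    rw [stabProj_basis_self, smul_sub, smul_sub, hform, hform, ← map_smul ι, ← map_smul ι,
      ← map_smul ι]
    simp only [intIdem]
    rw [sub_smul, mul_smul, hj, smul_smul, ← sq, map_sub ι, sub_self]
  -- If `b j` has stabilizer `L ≠ H`, then `p Ĥ b_j = Ĥ L̂ b_j = Ĝ b_j`, so `e_H` kills it.
  · rw [stabProj_basis_of_ne b hb S hS h, map_zero, map_zero, sub_zero, sub_zero, hform, ← map_smul ι]
    simp only [intIdem]
    rw [sub_smul, mul_smul, smul_comm, ← hj, smul_smul, subgroupSum_mul_of_ne hG (Ne.symm h),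
      sub_self, map_zero]

include b hb he hform hS in
theorem IsIdemSystem.diagram_of_permutation (hG : Nat.card G = p ^ 2) (hι : Function.Injective ι) :
    (∀ i g x, (single g 1 : MonoidAlgebra ℤ_[p] G) • e i (ι x) - e i (ι x) ∈ LinearMap.range ι) ∧
    (∀ H x, ∃ y, e (some H) (ι x) - e none (ι y) ∈ LinearMap.range ι) ∧
    (∀ x, ∃ w : OrderP p G → M, e none (ι x) - ∑ H, e (some H) (ι (w H)) ∈ LinearMap.range ι) ∧
    (∀ w : OrderP p G → M, ∑ H, e (some H) (ι (w H)) ∈ LinearMap.range ι →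
      ∀ H, e (some H) (ι (w H)) ∈ LinearMap.range ι) := by
  have key := idem_some_apply b hb he hform ι S hS hG
  refine ⟨fun i g x => ?_, fun H x => ?_, fun x => ?_, fun w hw K => ?_⟩
  · cases i with
    | none => rw [he.fix_none, sub_self]; exact Submodule.zero_mem _
    | some H =>
      rw [key, smul_sub, he.fix_none, sub_sub_sub_cancel_right, ← map_smul, ← map_sub]
      exact ⟨_, rfl⟩
  · refine ⟨- stabProj b hb S hS H x, stabProj b hb S hS H x, ?_⟩
    rw [key, map_neg, map_neg]; abel
  · refine ⟨fun _ => -x, x, ?_⟩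
    have h1 : ∑ H, ι (stabProj b hb S hS H x) = ι x := by rw [← map_sum, sum_stabProj]
    have h2 : ∑ H, e none (ι (stabProj b hb S hS H x)) = e none (ι x) := by rw [← map_sum, h1]
    simp only [map_neg, key, Finset.sum_neg_distrib, Finset.sum_sub_distrib, h1, h2]
    abel
  · obtain ⟨m, hm⟩ := hw
    simp only [key, Finset.sum_sub_distrib] at hm
    rw [← map_sum ι, ← map_sum (e none), ← map_sum ι] at hm
    -- The hypothesis becomes `e_0 k = k - m` with `m ∈ U`. Applying `π_K` to its multiple by `p²`
    -- gives `e_0 (π_K (w K)) ∈ U`, hence `e_K (w K) ∈ U`.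
    set k := ∑ H : OrderP p G, stabProj b hb S hS H (w H) with hk
    have hπ : stabProj b hb S hS K k = stabProj b hb S hS K (w K) := by
      rw [hk, map_sum, Finset.sum_eq_single K (fun H _ h => stabProj_stabProj_of_ne b hb S hS h.symm (w H))
        (by simp), stabProj_stabProj_self]
    have h1 : intIdem ℤ_[p] (none : Idx p G) • k = (p ^ 2 : MonoidAlgebra ℤ_[p] G) • (k - m) := by
      apply hι
      rw [map_smul, ← hform, map_smul, map_sub, hm, sub_sub_cancel]
    have h2 := congrArg (fun x => ι (stabProj b hb S hS K x)) h1
    simp only [map_smul, hπ] at h2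
    rw [← hform, ← sub_eq_zero, ← smul_sub] at h2
    have h3 := sub_eq_zero.mp (he.eq_zero_sq h2)
    rw [key, h3, ← map_sub]
    exact ⟨_, rfl⟩

end Forward

/-! ### The `e_i` are orthogonal idempotents with sum `1` -/

section RationalIdempotents

variable {p : ℕ} [Fact p.Prime] {G : Type*} [CommGroup G] [Fintype G]

theorem idem_eq (i : Idx p G) : idem p i = ((p : ℚ_[p]) ^ 2)⁻¹ • intIdem ℚ_[p] i := by
  cases i with
  | none => rfl
  | some H => rw [intIdem, ← nsmul_eq_mul, ← Nat.cast_smul_eq_nsmul ℚ_[p]]; rfl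

theorem natCast_ne_zero : (p : ℚ_[p]) ≠ 0 := Nat.cast_ne_zero.mpr (Fact.out : p.Prime).ne_zero

theorem natCast_mul_eq_smul (x : MonoidAlgebra ℚ_[p] G) :
    (p : MonoidAlgebra ℚ_[p] G) * x = (p : ℚ_[p]) • x := by
  rw [← nsmul_eq_mul, ← Nat.cast_smul_eq_nsmul ℚ_[p]]

theorem single_mul_idem_none (g : G) : single g 1 * idem p (none : Idx p G) = idem p none := by
  rw [idem_eq, mul_smul_comm]
  simp only [intIdem]
  rw [single_mul_subgroupSum (Subgroup.mem_top g)]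

theorem single_mul_idem_some {H : OrderP p G} {g : G} (hg : g ∈ H.1) :
    single g 1 * idem p (some H) = idem p (some H) := by
  rw [idem_eq, mul_smul_comm]
  simp only [intIdem]
  rw [mul_sub, mul_left_comm, single_mul_subgroupSum hg, single_mul_subgroupSum (Subgroup.mem_top g)]

theorem subgroupSum_top_mul_idem_none (hG : Nat.card G = p ^ 2) :
    subgroupSum ℚ_[p] (⊤ : Subgroup G) * idem p (none : Idx p G) = (p ^ 2 : ℚ_[p]) • idem p none := by
  rw [idem_eq, mul_smul_comm]
  simp only [intIdem]
  rw [subgroupSum_top_mul_top hG, smul_comm]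

theorem subgroupSum_top_mul_idem_some (hG : Nat.card G = p ^ 2) (H : OrderP p G) :
    subgroupSum ℚ_[p] (⊤ : Subgroup G) * idem p (some H) = 0 := by
  rw [idem_eq, mul_smul_comm]
  simp only [intIdem]
  rw [mul_sub, mul_left_comm, mul_comm _ (subgroupSum _ H.1), subgroupSum_mul_top,
    subgroupSum_top_mul_top hG, natCast_mul_eq_smul, smul_smul, sq, sub_self, smul_zero]

theorem subgroupSum_mul_idem_some (H : OrderP p G) :
    subgroupSum ℚ_[p] H.1 * idem p (some H) = (p : ℚ_[p]) • idem p (some H) := by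
  rw [subgroupSum_mul fun g hg => single_mul_idem_some hg, H.2]

theorem subgroupSum_mul_idem_some_of_ne (hG : Nat.card G = p ^ 2) {H L : OrderP p G} (h : H ≠ L) :
    subgroupSum ℚ_[p] H.1 * idem p (some L) = 0 := by
  rw [idem_eq, mul_smul_comm]
  simp only [intIdem]
  rw [mul_sub, mul_left_comm, subgroupSum_mul_of_ne hG h, subgroupSum_mul_top, natCast_mul_eq_smul,
    sub_self, smul_zero]

theorem idem_mul_self (hG : Nat.card G = p ^ 2) (i : Idx p G) : idem p i * idem p i = idem p i := by
  have hp : (p : ℚ_[p]) ≠ 0 := natCast_ne_zero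
  nth_rewrite 1 [idem_eq]
  cases i with
  | none =>
    simp only [intIdem]
    rw [smul_mul_assoc, subgroupSum_top_mul_idem_none hG, inv_smul_smul₀ (pow_ne_zero 2 hp)]
  | some H =>
    simp only [intIdem]
    rw [smul_mul_assoc, sub_mul, subgroupSum_top_mul_idem_some hG, sub_zero, mul_assoc,
      subgroupSum_mul_idem_some, natCast_mul_eq_smul, smul_smul (p : ℚ_[p]), ← sq,
      inv_smul_smul₀ (pow_ne_zero 2 hp)]

theorem idem_mul_of_ne (hG : Nat.card G = p ^ 2) {i j : Idx p G} (h : i ≠ j) :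
    idem p i * idem p j = 0 := by
  have h0 : ∀ H : OrderP p G, idem p none * idem p (some H) = 0 := fun H => by
    rw [idem_eq none]
    simp only [intIdem]
    rw [smul_mul_assoc, subgroupSum_top_mul_idem_some hG, smul_zero]
  match i, j with
  | none, none => exact (h rfl).elim
  | none, some H => exact h0 H
  | some H, none => rw [mul_comm]; exact h0 H
  | some H, some L =>
    have hHL : H ≠ L := fun e => h (by rw [e])
    rw [idem_eq (some H)]
    simp only [intIdem]
    rw [smul_mul_assoc, sub_mul, subgroupSum_top_mul_idem_some hG, mul_assoc,
      subgroupSum_mul_idem_some_of_ne hG hHL, mul_zero, sub_zero, smul_zero]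

/-- Multiplied by `p²` this is `Ĝ + p (Ĝ + p) - (p + 1) Ĝ = p²`. -/
theorem sum_idem (hG : Nat.card G = p ^ 2) (hexp : ∀ g : G, g ^ p = 1) :
    idem p none + ∑ H : OrderP p G, idem p (some H) = 1 := by
  have hp : (p : ℚ_[p]) ≠ 0 := natCast_ne_zero
  simp only [idem_eq]
  rw [← Finset.smul_sum, ← smul_add]
  simp only [intIdem]
  rw [Finset.sum_sub_distrib, ← Finset.mul_sum, sum_subgroupSum hG hexp, Finset.sum_const,
    Finset.card_univ, card_orderP hG hexp, inv_smul_eq_iff₀ (pow_ne_zero 2 hp)]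
  have : ((p : ℚ_[p]) ^ 2) • (1 : MonoidAlgebra ℚ_[p] G) = (p : MonoidAlgebra ℚ_[p] G) * p := by
    rw [natCast_mul_eq_smul, ← mul_one (p : MonoidAlgebra ℚ_[p] G), natCast_mul_eq_smul, smul_smul, sq]
  rw [this, nsmul_eq_mul]
  push_cast
  ring

end RationalIdempotents

/-! ### Representations as `ℤ_p G`-modules, and the idempotents acting on `ℚ_p U` -/

section Representation

variable {p : ℕ} [Fact p.Prime] {G : Type*} [CommGroup G]

section

variable {V : Type*} [AddCommGroup V] [Module ℤ_[p] V] (τ : Representation ℤ_[p] G V)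

/-- The `ℤ_p G`-module attached to a representation. -/
abbrev repModule : Module (MonoidAlgebra ℤ_[p] G) V :=
  Module.compHom V τ.asAlgebraHom.toRingHom

theorem repModule_smul (a : MonoidAlgebra ℤ_[p] G) (x : V) :
    letI := repModule τ
    a • x = τ.asAlgebraHom a x := rfl

theorem repModule_single_smul (g : G) (x : V) :
    letI := repModule τ
    (single g 1 : MonoidAlgebra ℤ_[p] G) • x = τ g x := by
  rw [repModule_smul, Representation.asAlgebraHom_single_one]

theorem repModule_isScalarTower :
    letI := repModule τ
    IsScalarTower ℤ_[p] (MonoidAlgebra ℤ_[p] G) V := by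
  let _ := repModule τ
  exact ⟨fun r a x => by rw [repModule_smul, repModule_smul, map_smul, LinearMap.smul_apply]⟩

end

variable {U : Type*} [AddCommGroup U] [Module ℤ_[p] U] (ρ : Representation ℤ_[p] G U)
  [Module (MonoidAlgebra ℤ_[p] G) U] [IsScalarTower ℤ_[p] (MonoidAlgebra ℤ_[p] G) U]
  (hU : ∀ (g : G) (u : U), (single g 1 : MonoidAlgebra ℤ_[p] G) • u = ρ g u)
  [Module (MonoidAlgebra ℤ_[p] G) (ℚ_[p] ⊗[ℤ_[p]] U)]
  [IsScalarTower ℤ_[p] (MonoidAlgebra ℤ_[p] G) (ℚ_[p] ⊗[ℤ_[p]] U)]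
  (hE : ∀ (g : G) (x : ℚ_[p] ⊗[ℤ_[p]] U), (single g 1 : MonoidAlgebra ℤ_[p] G) • x = intRep ρ g x)

/-- The inclusion `U → ℚ_p U`. -/
def inclusion : U →ₗ[MonoidAlgebra ℤ_[p] G] ℚ_[p] ⊗[ℤ_[p]] U :=
  MonoidAlgebra.equivariantOfLinearOfComm (TensorProduct.mk ℤ_[p] ℚ_[p] U 1) fun g v => by
    rw [hU, hE]; rfl

theorem mk_one_injective [Module.Free ℤ_[p] U] :
    Function.Injective (TensorProduct.mk ℤ_[p] ℚ_[p] U 1) := by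
  have h := Module.Flat.rTensor_preserves_injective_linearMap (M := U)
    (Algebra.linearMap ℤ_[p] ℚ_[p]) (IsFractionRing.injective ℤ_[p] ℚ_[p])
  have e : (TensorProduct.mk ℤ_[p] ℚ_[p] U 1 : U → _) =
      (Algebra.linearMap ℤ_[p] ℚ_[p]).rTensor U ∘ (TensorProduct.lid ℤ_[p] U).symm := by
    ext u; simp
  rw [e]
  exact h.comp (LinearEquiv.injective _)

variable [Fintype G]

/-- The action of `e_i` on `ℚ_p U`. -/
def idemEnd (i : Idx p G) :
    ℚ_[p] ⊗[ℤ_[p]] U →ₗ[MonoidAlgebra ℤ_[p] G] ℚ_[p] ⊗[ℤ_[p]] U :=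
  MonoidAlgebra.equivariantOfLinearOfComm
    (((ratRep ρ).asAlgebraHom (idem p i)).restrictScalars ℤ_[p]) fun g v => by
      rw [hE, hE]
      change (ratRep ρ).asAlgebraHom (idem p i) (ratRep ρ g v) =
        ratRep ρ g ((ratRep ρ).asAlgebraHom (idem p i) v)
      rw [← Representation.asAlgebraHom_single_one, ← Module.End.mul_apply, ← Module.End.mul_apply,
        ← map_mul, ← map_mul, mul_comm]

theorem idemEnd_apply (i : Idx p G) (x : ℚ_[p] ⊗[ℤ_[p]] U) :
    idemEnd ρ hE i x = (ratRep ρ).asAlgebraHom (idem p i) x := rfl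

theorem idemEnd_inclusion (i : Idx p G) (u : U) :
    idemEnd ρ hE i (inclusion ρ hU hE u) = idemMul ρ i u := rfl

section

include hE

theorem subgroupSum_smul_eq (H : Subgroup G) (x : ℚ_[p] ⊗[ℤ_[p]] U) :
    subgroupSum ℤ_[p] H • x = (ratRep ρ).asAlgebraHom (subgroupSum ℚ_[p] H) x := by
  classical
  rw [subgroupSum, Finset.sum_smul, subgroupSum, map_sum, LinearMap.sum_apply]
  refine Finset.sum_congr rfl fun g _ => ?_
  rw [hE, Representation.asAlgebraHom_single_one]
  rfl

theorem natCast_smul_eq_natCast_smul (n : ℕ) (x : ℚ_[p] ⊗[ℤ_[p]] U) :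
    (n : MonoidAlgebra ℤ_[p] G) • x = (n : ℚ_[p]) • x := by
  rw [Nat.cast_smul_eq_nsmul, Nat.cast_smul_eq_nsmul]

theorem intIdem_smul_eq (i : Idx p G) (x : ℚ_[p] ⊗[ℤ_[p]] U) :
    intIdem ℤ_[p] i • x = (ratRep ρ).asAlgebraHom (intIdem ℚ_[p] i) x := by
  cases i with
  | none => exact subgroupSum_smul_eq ρ hE ⊤ x
  | some H =>
    simp only [intIdem]
    rw [sub_smul, mul_smul, subgroupSum_smul_eq ρ hE, subgroupSum_smul_eq ρ hE,
      natCast_smul_eq_natCast_smul ρ hE, natCast_mul_eq_smul, map_sub, map_smul]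
    rfl

theorem sq_smul_idemEnd (i : Idx p G) (x : ℚ_[p] ⊗[ℤ_[p]] U) :
    (p ^ 2 : MonoidAlgebra ℤ_[p] G) • idemEnd ρ hE i x = intIdem ℤ_[p] i • x := by
  rw [← Nat.cast_pow, natCast_smul_eq_natCast_smul ρ hE, idemEnd_apply, idem_eq, map_smul,
    intIdem_smul_eq ρ hE, Nat.cast_pow, LinearMap.smul_apply,
    smul_inv_smul₀ (pow_ne_zero 2 natCast_ne_zero)]

theorem isIdemSystem (hG : Nat.card G = p ^ 2) (hexp : ∀ g : G, g ^ p = 1) :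
    IsIdemSystem (idemEnd ρ hE) where
  eq_zero x hx := by
    rw [natCast_smul_eq_natCast_smul ρ hE] at hx
    exact (smul_eq_zero_iff_right natCast_ne_zero).mp hx
  idem i x := by
    rw [idemEnd_apply, idemEnd_apply, ← Module.End.mul_apply, ← map_mul, idem_mul_self hG]
  orth i j x h := by
    rw [idemEnd_apply, idemEnd_apply, ← Module.End.mul_apply, ← map_mul, idem_mul_of_ne hG h,
      map_zero, LinearMap.zero_apply]
  sum x := by
    have h1 := congrArg (fun a => (ratRep ρ).asAlgebraHom a x) (sum_idem hG hexp)
    simp only [map_add, map_sum, map_one, LinearMap.add_apply, LinearMap.sum_apply] at h1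
    exact h1
  fix_none g x := by
    rw [hE]
    change ratRep ρ g ((ratRep ρ).asAlgebraHom (idem p none) x) = _
    rw [← Representation.asAlgebraHom_single_one, ← Module.End.mul_apply, ← map_mul,
      single_mul_idem_none, idemEnd_apply]
  fix_some H g hg x := by
    rw [hE]
    change ratRep ρ g ((ratRep ρ).asAlgebraHom (idem p (some H)) x) = _
    rw [← Representation.asAlgebraHom_single_one, ← Module.End.mul_apply, ← map_mul,
      single_mul_idem_some hg, idemEnd_apply]
  norm H x := by
    rw [idemEnd_apply, subgroupSum_smul_eq ρ hE, ← Module.End.mul_apply, ← map_mul,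
      subgroupSum_top_mul_idem_some hG, map_zero, LinearMap.zero_apply]

end

theorem mem_lattice {x : ℚ_[p] ⊗[ℤ_[p]] U} :
    x ∈ (lattice ρ).toSubmodule ↔ x ∈ LinearMap.range (inclusion ρ hU hE) :=
  Iff.rfl

theorem mem_part {i : Idx p G} {x : ℚ_[p] ⊗[ℤ_[p]] U} :
    x ∈ (part ρ i).toSubmodule ↔ x ∈ (LinearMap.range (inclusion ρ hU hE)).map (idemEnd ρ hE i) := by
  constructor
  · rintro ⟨u, rfl⟩; exact ⟨_, ⟨u, rfl⟩, rfl⟩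
  · rintro ⟨_, ⟨u, rfl⟩, rfl⟩; exact ⟨u, rfl⟩

end Representation

/-! ### Translating conditions on `V` into conditions in `ℚ_p U` -/

section Diagram

variable {p : ℕ} [Fact p.Prime] {G : Type*} [CommGroup G] [Fintype G]
variable {U : Type*} [AddCommGroup U] [Module ℤ_[p] U] (ρ : Representation ℤ_[p] G U)

theorem part_le_hull (i : Idx p G) : (part ρ i).toSubmodule ≤ (hull ρ).toSubmodule :=
  le_iSup (fun i : Idx p G => (part ρ i).toSubmodule) i

/-- The map `U_* → V`. -/
abbrev toDiagram : (hull ρ).toSubmodule →ₗ[ℤ_[p]] DiagramSpace ρ := Submodule.mkQ _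

theorem toDiagram_eq_zero {x : (hull ρ).toSubmodule} :
    toDiagram ρ x = 0 ↔ (x : ℚ_[p] ⊗[ℤ_[p]] U) ∈ (lattice ρ).toSubmodule := by
  rw [toDiagram, Submodule.mkQ_apply, Submodule.Quotient.mk_eq_zero]
  rfl

theorem diagramPart_eq (i : Idx p G) : diagramPart ρ i =
    ((part ρ i).toSubmodule.submoduleOf (hull ρ).toSubmodule).map (toDiagram ρ) := by
  apply le_antisymm
  · rintro _ ⟨⟨x, hx⟩, hx', rfl⟩
    obtain ⟨y, hy, u, hu, rfl⟩ := Submodule.mem_sup.mp hx'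
    have hy' := part_le_hull ρ i hy
    refine ⟨⟨y, hy'⟩, hy, ?_⟩
    rw [← sub_eq_zero, ← map_sub, toDiagram_eq_zero]
    simpa using hu
  · exact Submodule.map_mono (Submodule.comap_mono le_sup_left)

theorem mem_diagramPart {i : Idx p G} {v : DiagramSpace ρ} : v ∈ diagramPart ρ i ↔
    ∃ x, ∃ hx : x ∈ (part ρ i).toSubmodule, toDiagram ρ ⟨x, part_le_hull ρ i hx⟩ = v := by
  rw [diagramPart_eq]
  constructor
  · rintro ⟨⟨x, hx⟩, hx', rfl⟩; exact ⟨x, hx', rfl⟩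
  · rintro ⟨x, hx, rfl⟩; exact ⟨_, hx, rfl⟩

theorem trivial_iff (i : Idx p G) (g : G) :
    (∀ v ∈ diagramPart ρ i, diagramRep ρ g v = v) ↔
      ∀ x ∈ (part ρ i).toSubmodule, intRep ρ g x - x ∈ (lattice ρ).toSubmodule := by
  have key : ∀ x : (hull ρ).toSubmodule, diagramRep ρ g (toDiagram ρ x) = toDiagram ρ x ↔
      intRep ρ g (x : ℚ_[p] ⊗[ℤ_[p]] U) - x ∈ (lattice ρ).toSubmodule := by
    intro x
    have : diagramRep ρ g (toDiagram ρ x) = toDiagram ρ ((hull ρ).toRepresentation g x) := rfl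
    rw [this, ← sub_eq_zero, ← map_sub, toDiagram_eq_zero]
    rfl
  constructor
  · intro h x hx
    exact (key _).mp (h _ ((mem_diagramPart ρ).mpr ⟨x, hx, rfl⟩))
  · intro h v hv
    obtain ⟨x, hx, rfl⟩ := (mem_diagramPart ρ).mp hv
    exact (key _).mpr (h x hx)

theorem eq_top_of_diagramPart_le {S : Submodule ℤ_[p] (DiagramSpace ρ)} (h : ∀ i, diagramPart ρ i ≤ S) : S = ⊤ := by
  rw [eq_top_iff]
  rintro v -
  obtain ⟨⟨x, hx⟩, rfl⟩ := Submodule.mkQ_surjective _ v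
  have h1 : (hull ρ).toSubmodule ≤ (S.comap (toDiagram ρ)).map (hull ρ).toSubmodule.subtype := by
    refine iSup_le fun i y hy => ?_
    exact ⟨⟨y, part_le_hull ρ i hy⟩, h i ((mem_diagramPart ρ).mpr ⟨y, hy, rfl⟩), rfl⟩
  obtain ⟨y, hy, e⟩ := h1 hx
  have : y = ⟨x, hx⟩ := Subtype.ext e
  exact this ▸ hy

theorem diagramPart_none_eq_top_iff : diagramPart ρ none = ⊤ ↔
    ∀ H, ∀ x ∈ (part ρ (some H)).toSubmodule, ∃ y ∈ (part ρ none).toSubmodule,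
      x - y ∈ (lattice ρ).toSubmodule := by
  constructor
  · intro h H x hx
    obtain ⟨y, hy, e⟩ := (mem_diagramPart ρ).mp
      (h ▸ Submodule.mem_top (x := toDiagram ρ ⟨x, part_le_hull ρ _ hx⟩))
    refine ⟨y, hy, ?_⟩
    rw [eq_comm, ← sub_eq_zero, ← map_sub, toDiagram_eq_zero] at e
    exact e
  · intro h
    refine eq_top_of_diagramPart_le ρ fun i => ?_
    cases i with
    | none => exact le_rfl
    | some H =>
      intro v hv
      obtain ⟨x, hx, rfl⟩ := (mem_diagramPart ρ).mp hv
      obtain ⟨y, hy, hxy⟩ := h H x hx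
      refine (mem_diagramPart ρ).mpr ⟨y, hy, ?_⟩
      rw [eq_comm, ← sub_eq_zero, ← map_sub, toDiagram_eq_zero]
      exact hxy

theorem sum_toDiagram {w : OrderP p G → ℚ_[p] ⊗[ℤ_[p]] U}
    (hw : ∀ H, w H ∈ (hull ρ).toSubmodule) :
    ∑ H, toDiagram ρ ⟨w H, hw H⟩ = toDiagram ρ ⟨∑ H, w H, Submodule.sum_mem _ fun H _ => hw H⟩ := by
  rw [← map_sum]
  congr 1
  apply Subtype.ext
  simp

/-- Because `V = V_(0)`, only classes of elements of `U_(0)` have to be decomposed. -/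
theorem iSup_diagramPart_eq_top_iff (h0 : diagramPart ρ none = ⊤) :
    ⨆ H : OrderP p G, diagramPart ρ (some H) = ⊤ ↔
    ∀ x ∈ (part ρ none).toSubmodule, ∃ w : OrderP p G → ℚ_[p] ⊗[ℤ_[p]] U,
      (∀ H, w H ∈ (part ρ (some H)).toSubmodule) ∧ x - ∑ H, w H ∈ (lattice ρ).toSubmodule := by
  constructor
  · intro h x hx
    obtain ⟨f, hf⟩ := (Submodule.mem_iSup_iff_exists_finsupp _ _).mp
      (h ▸ Submodule.mem_top (x := toDiagram ρ ⟨x, part_le_hull ρ _ hx⟩))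
    choose w hw hwf using fun H => (mem_diagramPart ρ).mp (hf.1 H)
    refine ⟨w, hw, ?_⟩
    have h1 := hf.2
    rw [Finsupp.sum_fintype _ _ (fun _ => rfl)] at h1
    simp only [← hwf] at h1
    rw [sum_toDiagram ρ fun H => part_le_hull ρ _ (hw H), eq_comm, ← sub_eq_zero, ← map_sub,
      toDiagram_eq_zero] at h1
    exact h1
  · intro h
    rw [eq_top_iff, ← h0]
    intro v hv
    obtain ⟨x, hx, rfl⟩ := (mem_diagramPart ρ).mp hv
    obtain ⟨w, hw, hxw⟩ := h x hx
    have : toDiagram ρ ⟨x, part_le_hull ρ _ hx⟩ =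
        ∑ H, toDiagram ρ ⟨w H, part_le_hull ρ _ (hw H)⟩ := by
      rw [sum_toDiagram ρ fun H => part_le_hull ρ _ (hw H), ← sub_eq_zero, ← map_sub,
        toDiagram_eq_zero]
      exact hxw
    rw [this]
    exact Submodule.sum_mem _ fun H _ => Submodule.mem_iSup_of_mem H
      ((mem_diagramPart ρ).mpr ⟨w H, hw H, rfl⟩)

theorem iSupIndep_diagramPart_iff : iSupIndep (fun H : OrderP p G => diagramPart ρ (some H)) ↔
    ∀ w : OrderP p G → ℚ_[p] ⊗[ℤ_[p]] U, (∀ H, w H ∈ (part ρ (some H)).toSubmodule) →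
      ∑ H, w H ∈ (lattice ρ).toSubmodule → ∀ H, w H ∈ (lattice ρ).toSubmodule := by
  classical
  rw [iSupIndep_iff_finsetSum_eq_zero_imp_eq_zero]
  constructor
  · intro h w hw hs H
    refine (toDiagram_eq_zero ρ (x := ⟨w H, part_le_hull ρ _ (hw H)⟩)).mp ?_
    refine h Finset.univ (fun H => toDiagram ρ ⟨w H, part_le_hull ρ _ (hw H)⟩)
      (fun H _ => (mem_diagramPart ρ).mpr ⟨w H, hw H, rfl⟩) ?_ H (Finset.mem_univ H)
    rw [sum_toDiagram ρ fun H => part_le_hull ρ _ (hw H), toDiagram_eq_zero]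
    exact hs
  · intro h s v hv hs H hH
    -- A family on the finite set `s` is extended by zero to all `H`, so that the hypothesis about
    -- full families applies.
    have h1 : ∀ H, ∃ x, ∃ hx : x ∈ (part ρ (some H)).toSubmodule,
        toDiagram ρ ⟨x, part_le_hull ρ _ hx⟩ = if H ∈ s then v H else 0 := fun H =>
      (mem_diagramPart ρ).mp (by split_ifs with h; exacts [hv H h, Submodule.zero_mem _])
    choose w hw hwv using h1
    have h2 := h w hw (by
      refine (toDiagram_eq_zero ρ
        (x := ⟨_, Submodule.sum_mem _ fun H _ => part_le_hull ρ _ (hw H)⟩)).mp ?_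
      rw [← sum_toDiagram ρ fun H => part_le_hull ρ _ (hw H)]
      simp only [hwv, Finset.sum_ite_mem, Finset.univ_inter, hs]) H
    have h3 := hwv H
    rw [if_pos hH] at h3
    rw [← h3, toDiagram_eq_zero]
    exact h2

end Diagram

variable {p : ℕ} [Fact p.Prime] {G : Type*} [CommGroup G]

/-! ### Cyclic direct summands -/

section Summand

variable {U : Type*} [AddCommGroup U] [Module ℤ_[p] U] (ρ : Representation ℤ_[p] G U)
  [Module (MonoidAlgebra ℤ_[p] G) U] [IsScalarTower ℤ_[p] (MonoidAlgebra ℤ_[p] G) U]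
  (hU : ∀ (g : G) (u : U), (single g 1 : MonoidAlgebra ℤ_[p] G) • u = ρ g u)

/-- A `ℤ_p G`-submodule, as a subrepresentation. -/
def toSubrep (N : Submodule (MonoidAlgebra ℤ_[p] G) U) : Subrepresentation ρ where
  toSubmodule := N.restrictScalars ℤ_[p]
  apply_mem_toSubmodule g v hv := by
    rw [← hU]
    exact N.smul_mem _ hv

theorem isCompl_toSubrep {N N' : Submodule (MonoidAlgebra ℤ_[p] G) U} (h : IsCompl N N') :
    IsCompl (toSubrep ρ hU N) (toSubrep ρ hU N') := by
  constructor
  · rw [disjoint_iff_inf_le]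
    intro x hx
    exact (Submodule.mem_bot _).mp (h.disjoint.le_bot ⟨hx.1, hx.2⟩)
  · rw [codisjoint_iff_le_sup]
    intro x _
    obtain ⟨y, hy, z, hz, e⟩ := Submodule.mem_sup.mp (h.codisjoint.top_le (Submodule.mem_top (x := x)))
    exact Submodule.mem_sup.mpr ⟨y, hy, z, hz, e⟩

-- The span of `u` and `W` are quotients of `ℤ_p G` by the same kernel, hence isomorphic compatibly
-- with `G`.
include hU in
theorem hasSummand_of_isCompl {W : Type*} [AddCommGroup W] [Module ℤ_[p] W]
    (σ : Representation ℤ_[p] G W) (u : U) {N : Submodule (MonoidAlgebra ℤ_[p] G) U}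
    (hN : IsCompl (Submodule.span (MonoidAlgebra ℤ_[p] G) {u}) N)
    (φ : MonoidAlgebra ℤ_[p] G →ₗ[ℤ_[p]] W) (hφ : Function.Surjective φ)
    (hφG : ∀ g a, φ (single g 1 * a) = σ g (φ a)) (hk : ∀ a, a • u = 0 ↔ φ a = 0) :
    HasSummand ρ σ := by
  refine ⟨toSubrep ρ hU _, toSubrep ρ hU N, isCompl_toSubrep ρ hU hN, ?_⟩
  let f : MonoidAlgebra ℤ_[p] G →ₗ[ℤ_[p]]
      (toSubrep ρ hU (Submodule.span (MonoidAlgebra ℤ_[p] G) {u})).toSubmodule :=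
    LinearMap.codRestrict _ ((LinearMap.toSpanSingleton (MonoidAlgebra ℤ_[p] G) U u).restrictScalars
      ℤ_[p]) fun a => Submodule.smul_mem _ a (Submodule.mem_span_singleton_self u)
  have hf : Function.Surjective f := by
    rintro ⟨x, hx⟩
    obtain ⟨a, rfl⟩ := Submodule.mem_span_singleton.mp hx
    exact ⟨a, rfl⟩
  have hker : LinearMap.ker f = LinearMap.ker φ := by
    ext a
    rw [LinearMap.mem_ker, LinearMap.mem_ker, ← hk]
    exact Subtype.ext_iff
  let e := (f.quotKerEquivOfSurjective hf).symm.trans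
    ((Submodule.quotEquivOfEq _ _ hker).trans (φ.quotKerEquivOfSurjective hφ))
  have he : ∀ a, e (f a) = φ a := by
    intro a
    have : f a = f.quotKerEquivOfSurjective hf (Submodule.Quotient.mk a) := rfl
    simp only [e, LinearEquiv.trans_apply]
    rw [this, LinearEquiv.symm_apply_apply]
    rfl
  refine ⟨Representation.Equiv.mk e fun g => LinearMap.ext fun x => ?_⟩
  obtain ⟨a, rfl⟩ := hf x
  have h1 : (toSubrep ρ hU (Submodule.span (MonoidAlgebra ℤ_[p] G) {u})).toRepresentation g (f a) =
      f (single g 1 * a) := by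
    apply Subtype.ext
    change ρ g (a • u) = (single g 1 * a) • u
    rw [mul_smul, hU]
  simp only [LinearMap.comp_apply, LinearEquiv.coe_coe]
  rw [h1, he, he, hφG]

end Summand

/-! ### Recognizing summands isomorphic to `Λ_(i)` -/

section Regular

theorem leftRegular_apply (g : G) (a : MonoidAlgebra ℤ_[p] G) :
    Representation.leftRegular ℤ_[p] G g a = single g 1 * a := by
  rw [← Representation.asAlgebraHom_ofMulAction_smul_eq_mul,
    Representation.asAlgebraHom_single_one]

variable [Fintype G]

theorem idemMul_leftRegular_eq_zero_iff (i : Idx p G) (a : MonoidAlgebra ℤ_[p] G) :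
    idemMul (Representation.leftRegular ℤ_[p] G) i a = 0 ↔ a ∈ idemAnn i := by
  let ρ := Representation.leftRegular ℤ_[p] G
  let _ := repModule (intRep ρ)
  have _ := repModule_isScalarTower (intRep ρ)
  have hU : ∀ (g : G) (u : MonoidAlgebra ℤ_[p] G),
    (single g 1 : MonoidAlgebra ℤ_[p] G) • u = ρ g u := fun g u => (leftRegular_apply g u).symm
  have hE := repModule_single_smul (intRep ρ)
  have hp : (p : ℚ_[p]) ≠ 0 := natCast_ne_zero
  have h1 := sq_smul_idemEnd ρ hE i (inclusion ρ hU hE a)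
  rw [← map_smul (inclusion ρ hU hE), idemEnd_inclusion, ← Nat.cast_pow, natCast_smul_eq_natCast_smul ρ hE] at h1
  have h2 : idemMul ρ i a = 0 ↔ inclusion ρ hU hE (intIdem ℤ_[p] i • a) = 0 := by
    rw [← h1, smul_eq_zero_iff_right (by simpa using hp)]
  rw [h2, mem_idemAnn, mul_comm, ← smul_eq_mul]
  exact map_eq_zero_iff (inclusion ρ hU hE) (mk_one_injective (p := p))

theorem hasSummand_lambda {U : Type*} [AddCommGroup U] [Module ℤ_[p] U]
    (ρ : Representation ℤ_[p] G U)
    [Module (MonoidAlgebra ℤ_[p] G) U] [IsScalarTower ℤ_[p] (MonoidAlgebra ℤ_[p] G) U]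
    (hU : ∀ (g : G) (u : U), (single g 1 : MonoidAlgebra ℤ_[p] G) • u = ρ g u)
    (u : U) {N : Submodule (MonoidAlgebra ℤ_[p] G) U}
    (hN : IsCompl (Submodule.span (MonoidAlgebra ℤ_[p] G) {u}) N)
    (i : Idx p G) (hk : ∀ a : MonoidAlgebra ℤ_[p] G, a • u = 0 ↔ a ∈ idemAnn i) :
    HasSummand ρ (lambda p G i) := by
  refine hasSummand_of_isCompl ρ hU (lambda p G i) u hN
    (LinearMap.codRestrict _ (idemMul (Representation.leftRegular ℤ_[p] G) i) fun a => ⟨a, rfl⟩)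
    ?_ (fun g a => ?_) fun a => ?_
  · rintro ⟨_, a, rfl⟩; exact ⟨a, rfl⟩
  · apply Subtype.ext
    change idemMul _ i (single g 1 * a) = intRep _ g (idemMul _ i a)
    rw [intRep_idemMul, leftRegular_apply]
  · rw [hk, ← idemMul_leftRegular_eq_zero_iff]
    exact ⟨fun h => Subtype.ext h, fun h => congrArg Subtype.val h⟩

end Regular

/-! ### The two implications -/

section Main

variable [Fintype G] {U : Type*} [AddCommGroup U] [Module ℤ_[p] U] [Module.Finite ℤ_[p] U]
  [Module.Free ℤ_[p] U] (ρ : Representation ℤ_[p] G U)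
  [Module (MonoidAlgebra ℤ_[p] G) U] [IsScalarTower ℤ_[p] (MonoidAlgebra ℤ_[p] G) U]
  (hU : ∀ (g : G) (u : U), (single g 1 : MonoidAlgebra ℤ_[p] G) • u = ρ g u)
  [Module (MonoidAlgebra ℤ_[p] G) (ℚ_[p] ⊗[ℤ_[p]] U)]
  [IsScalarTower ℤ_[p] (MonoidAlgebra ℤ_[p] G) (ℚ_[p] ⊗[ℤ_[p]] U)]
  (hE : ∀ (g : G) (x : ℚ_[p] ⊗[ℤ_[p]] U), (single g 1 : MonoidAlgebra ℤ_[p] G) • x = intRep ρ g x)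
  (hG : Nat.card G = p ^ 2) (hexp : ∀ g : G, g ^ p = 1) (hred : IsReduced ρ)

/-- The condition on the diagram of `U` in the main theorem, expressed in `ℚ_p U`. -/
def DiagramCondition : Prop :=
  (∀ (i : Idx p G) (g : G), ∀ x ∈ (part ρ i).toSubmodule,
    intRep ρ g x - x ∈ (lattice ρ).toSubmodule) ∧
  (∀ H, ∀ x ∈ (part ρ (some H)).toSubmodule, ∃ y ∈ (part ρ none).toSubmodule,
    x - y ∈ (lattice ρ).toSubmodule) ∧
  (∀ w : OrderP p G → ℚ_[p] ⊗[ℤ_[p]] U, (∀ H, w H ∈ (part ρ (some H)).toSubmodule) →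
    ∑ H, w H ∈ (lattice ρ).toSubmodule → ∀ H, w H ∈ (lattice ρ).toSubmodule) ∧
  ∀ x ∈ (part ρ none).toSubmodule, ∃ w : OrderP p G → ℚ_[p] ⊗[ℤ_[p]] U,
    (∀ H, w H ∈ (part ρ (some H)).toSubmodule) ∧ x - ∑ H, w H ∈ (lattice ρ).toSubmodule

omit [Module.Finite ℤ_[p] U] [Module.Free ℤ_[p] U] in
theorem diagramCondition_iff : DiagramCondition ρ ↔
    (∀ (i : Idx p G) (g : G), ∀ v ∈ diagramPart ρ i, diagramRep ρ g v = v) ∧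
      diagramPart ρ none = ⊤ ∧ (iSupIndep (fun H : OrderP p G => diagramPart ρ (some H)) ∧
        ⨆ H : OrderP p G, diagramPart ρ (some H) = ⊤) := by
  simp only [trivial_iff, DiagramCondition, ← iSupIndep_diagramPart_iff,
    ← diagramPart_none_eq_top_iff]
  refine and_congr_right fun _ => and_congr_right fun h0 => and_congr_right fun _ => ?_
  exact (iSup_diagramPart_eq_top_iff ρ h0).symm

include hU hE hG hexp hred

theorem isPermutation_of_diagramCondition (h : DiagramCondition ρ) : IsPermutation ρ := by
  obtain ⟨hT, h0, hI, hS⟩ := h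
  set ι := inclusion ρ hU hE with hι
  have hinj : Function.Injective ι := mk_one_injective (p := p)
  simp only [mem_part ρ hU hE, mem_lattice ρ hU hE] at hT h0 hI hS
  have he := isIdemSystem ρ hE hG hexp
  have hfin : Module.Finite (MonoidAlgebra ℤ_[p] G) U :=
    Module.Finite.of_restrictScalars_finite ℤ_[p] _ _
  have hFG : (LinearMap.range ι).FG := by
    rw [LinearMap.range_eq_map]; exact hfin.fg_top.map ι
  obtain ⟨n, z, hzU, hzH, hzspan, hzind⟩ := he.exists_generators hG hexp hFG
    -- Reducedness enters here: an element of `U ∩ U_(i)` outside `𝔪 U_(i)` would generate a summand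
    -- with annihilator `ann e_i`, a copy of `Λ_(i)`.
    (fun i => by
      rintro _ ⟨⟨u, rfl⟩, hui⟩
      by_contra hu
      obtain ⟨h1, W, h2, h3⟩ := he.exists_complement hG hexp i hFG ⟨u, rfl⟩ hui hu
      refine hred.2 i (hasSummand_lambda ρ hU u (N := W.comap ι) ?_ i fun a => ?_)
      · constructor
        · rw [disjoint_iff_inf_le]
          rintro x ⟨hx, hx'⟩
          obtain ⟨a, rfl⟩ := Submodule.mem_span_singleton.mp hx
          rw [SetLike.mem_coe, Submodule.mem_comap, map_smul] at hx'
          exact hinj (by rw [map_smul, h2 a hx', map_zero])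
        · rw [codisjoint_iff_le_sup]
          intro x _
          obtain ⟨a, ha⟩ := h3 (ι x) ⟨x, rfl⟩
          refine Submodule.mem_sup.mpr ⟨a • u, Submodule.smul_mem _ _
            (Submodule.mem_span_singleton_self u), x - a • u, ?_, add_sub_cancel _ _⟩
          rw [Submodule.mem_comap, map_sub, map_smul]
          exact ha
      · rw [← h1, ← map_smul]
        exact (map_eq_zero_iff ι hinj).symm)
    (fun i g x hx => by rw [hE]; exact hT i g x hx) h0 hS hI
  choose z' hz' using hzU
  obtain ⟨m, b, hb⟩ := exists_permuted_basis (M := U) (fun s : Σ H, Fin (n H) => s.1.1) z'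
    (fun s g hg => hinj (by rw [map_smul, hz', hzH s g hg]))
    (fun x _ => by
      obtain ⟨c, hc⟩ := (Submodule.mem_span_range_iff_exists_fun _).mp (hzspan ⟨x, rfl⟩)
      refine (Submodule.mem_span_range_iff_exists_fun _).mpr ⟨c, hinj ?_⟩
      rw [map_sum, ← hc]
      exact Finset.sum_congr rfl fun s _ => by rw [map_smul, hz'])
    (fun a ha => hzind a (by
      have := congrArg ι ha
      rw [map_sum, map_zero] at this
      rw [← this]
      exact Finset.sum_congr rfl fun s _ => by rw [map_smul, hz']))
  exact ⟨m, b, fun g i => by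
    obtain ⟨j, hj⟩ := hb g i
    exact ⟨j, by rw [← hU, hj]⟩⟩

theorem diagramCondition_of_isPermutation (h : IsPermutation ρ) : DiagramCondition ρ := by
  obtain ⟨n, b, hb⟩ := h
  choose a ha using hb
  let _ : MulAction G (Fin n) :=
    { smul := a
      one_smul := fun i => b.injective (by
        change b (a 1 i) = b i
        rw [← ha, map_one]; rfl)
      mul_smul := fun g g' i => b.injective (by
        change b (a (g * g') i) = b (a g (a g' i))
        rw [← ha, ← ha, ← ha, map_mul]; rfl) }
  have hb : ∀ (g : G) i, (single g 1 : MonoidAlgebra ℤ_[p] G) • b i = b (g • i) := fun g i => by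
    rw [hU, ha]; rfl
  -- The order divides `p²`. Order `1` would make the orbit span a copy of `ℤ_p G`, and order `p²` a
  -- copy of `Λ_(0)`.
  have hstab : ∀ i : Fin n, Nat.card (MulAction.stabilizer G i) = p := by
    intro i
    have hp : p.Prime := Fact.out
    have hd : Nat.card (MulAction.stabilizer G i) ∣ p ^ 2 := hG ▸ Subgroup.card_subgroup_dvd_card _
    obtain ⟨W, hW⟩ := exists_isCompl_span_basis b hb i
    obtain ⟨k, hk, e⟩ := (Nat.dvd_prime_pow hp).mp hd
    interval_cases k
    · refine (hred.1 (hasSummand_of_isCompl ρ hU _ (b i) hW LinearMap.id (fun x => ⟨x, rfl⟩)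
        (fun g x => (leftRegular_apply g x).symm) fun x => ?_)).elim
      exact smul_basis_eq_zero_iff_of_stabilizer_eq_bot b hb
        (Subgroup.eq_bot_of_card_eq _ (by rw [e, pow_zero])) x
    · rw [e, pow_one]
    · refine (hred.2 none (hasSummand_lambda ρ hU (b i) hW none fun x => ?_)).elim
      rw [smul_basis_eq_zero_iff_of_stabilizer_eq_top b hb
        (Subgroup.eq_top_of_card_eq _ (by rw [e, hG])), mem_idemAnn]
      simp only [intIdem]
      rw [mul_subgroupSum_top]
      refine ⟨fun h => by rw [h, zero_smul], fun h => ?_⟩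
      have := congrArg (fun y => MonoidAlgebra.coeff y 1) h
      simpa [coeff_subgroupSum] using this
  have he := isIdemSystem ρ hE hG hexp
  obtain ⟨h1, h2, h3, h4⟩ := he.diagram_of_permutation b hb (sq_smul_idemEnd ρ hE)
    (inclusion ρ hU hE) (fun i : Fin n => ⟨MulAction.stabilizer G i, hstab i⟩) (fun _ => rfl) hG
    (mk_one_injective (p := p))
  refine ⟨?_, ?_, ?_, ?_⟩
  · rintro i g _ ⟨u, rfl⟩
    rw [← hE]
    exact h1 i g u
  · rintro H _ ⟨u, rfl⟩
    obtain ⟨y, hy⟩ := h2 H u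
    exact ⟨_, ⟨y, rfl⟩, hy⟩
  · intro w hw hs
    choose v hv using hw
    obtain rfl : (fun H => idemMul ρ (some H) (v H)) = w := funext hv
    exact h4 v hs
  · rintro _ ⟨u, rfl⟩
    obtain ⟨w, hw⟩ := h3 u
    exact ⟨_, fun H => ⟨w H, rfl⟩, hw⟩

end Main

end Butler

end

theorem mainTheorem2 (p : ℕ) [Fact p.Prime] {G : Type*} [CommGroup G] [Fintype G]
    (hG : Nonempty (G ≃* Multiplicative (ZMod p) × Multiplicative (ZMod p)))
    {U : Type*} [AddCommGroup U] [Module ℤ_[p] U] [Module.Finite ℤ_[p] U] [Module.Free ℤ_[p] U]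
    (ρ : Representation ℤ_[p] G U) (hU : Butler.IsReduced ρ) :
    Butler.IsPermutation ρ ↔
      (∀ (i : Butler.Idx p G) (g : G), ∀ v ∈ Butler.diagramPart ρ i,
        Butler.diagramRep ρ g v = v) ∧
      Butler.diagramPart ρ none = ⊤ ∧
      (iSupIndep (fun H : Butler.OrderP p G => Butler.diagramPart ρ (some H)) ∧
        ⨆ H : Butler.OrderP p G, Butler.diagramPart ρ (some H) = ⊤) := by
  let _ := Butler.repModule ρ
  have _ := Butler.repModule_isScalarTower ρ
  let _ := Butler.repModule (Butler.intRep ρ)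
  have _ := Butler.repModule_isScalarTower (Butler.intRep ρ)
  have hcard := Butler.card_eq_sq hG
  have hexp := Butler.pow_eq_one hG
  rw [← Butler.diagramCondition_iff]
  exact ⟨Butler.diagramCondition_of_isPermutation ρ (Butler.repModule_single_smul ρ)
      (Butler.repModule_single_smul (Butler.intRep ρ)) hcard hexp hU,
    Butler.isPermutation_of_diagramCondition ρ (Butler.repModule_single_smul ρ)
      (Butler.repModule_single_smul (Butler.intRep ρ)) hcard hexp hU⟩
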